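/- **Setting.** Consider $n=2m$ qubits on a ring, labelled $0,\dots,n-1$. A depth-$t$ brickwork random quantum circuit $U\sim\nu_{\rm bw}$ is the product of $t$ layers of independent Haar-random two-qubit gates from $U(4)$: the 1st, 3rd, … layer acts on the pairs $(0,1),(2,3),\dots,(n-2,n-1)$, the 2nd, 4th, … layer on $(1,2),(3,4),\dots,(n-1,0)$ (periodic boundary conditions). Let $A$ be a contiguous block of $n_A$ qubits, $B$ its complement with $n_B=n-n_A$ qubits, $n_A<n_B$, $D_A=2^{n_A}$, $D_B=2^{n_B}$, and for a pure state $|\psi\rangle$ of the $n$ qubits put $\rho_A={\rm tr}_B(U|\psi\rangle\langle\psi|U^\dagger)$. Let $\mathcal D(\rho,\sigma)=\frac12\|\rho-\sigma\|_1$ be the trace distance. For a set $\mathsf G$ of two-qubit gates (one-qubit gates included as $u\otimes\mathbb I$), the $\delta$-complexity $\mathcal C_\delta(\rho)$ of a $k$-qubit state $\rho$, relative to a register of $N$ qubits (system and ancillas) initialized in $|0\cdots0\rangle$, is the least $r$ for which there are a product $V$ of $r$ gates from $\mathsf G$, each applied to some ordered pair of distinct qubits of the register, and $k$ qubits of the register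 such that the reduced state of $V|0\cdots0\rangle$ on these $k$ qubits is within trace distance $\delta$ of $\rho$ (and $\infty$ if there is none). **Statement.** There is an absolute constant $c$ such that the following hold. The event whose probability is bounded from below always means: its failure has (outer) probability at most $\eta$. 1. For all $\varepsilon,\eta>0$ there is $T$ such that for every gate set $\mathsf G$, every register size $N$, all $n$, all contiguous $A$ with $n_A<n_B$ and $D_B\ge 2^{T}D_A$, every pure state $|\psi\rangle$ and every depth $t\ge c\,n_A+T$, with probability at least $1-\eta$ over $U\sim\nu_{\rm bw}$, $$\mathcal C_{\delta+\varepsilon}(\mathbb I_A/D_A)\le \mathcal C_\delta(\rho_A)\le \mathcal C_{\delta-\varepsilon}(\mathbb I_A/D_A)\qquad\text{for all }\delta\ge\varepsilon .$$ 2. Let $\mathsf G$ be a gate set for which some circuit over $\mathsf G$ on two qubits turns $|00\rangle$ into a maximally entangled (EPR) pair (for instance any set containing the Hadamard and CNOT gates, such as the universal set $\{H,T,\mathrm{CNOT}\}$). Then there is a constant $K=K(\mathsf G)$ such that: (a) $\mathcal C_\delta(\mathbb I_A/D_A)\le K\,n_A$ for all $n_A$, all $\delta\ge0$ and every register of $N\ge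 2n_A$ qubits; (b) for every function $a:\mathbb N\to\mathbb N$ (the number $a(n)$ of ancillas, so that the register has $N=n+a(n)$ qubits; for example a polynomial) and for Lebesgue-almost every $\delta>0$: for every $\eta>0$ there is $T$ such that for all $n$, all contiguous $A$ with $n_A<n_B$ and $D_B\ge 2^T(n_A+1)^5D_A$, every pure state $|\psi\rangle$ and every depth $t\ge c\,n_A+T$, with probability at least $1-\eta$ over $U\sim\nu_{\rm bw}$, $$\mathcal C_\delta(\rho_A)=\mathcal C_\delta(\mathbb I_A/D_A)\le K\,n_A .$$ In particular, in (b) $n_A/n$ may be any fraction bounded by a fixed $p<1/2$ with $n$ large. -/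

import Mathlib

open MeasureTheory
open scoped Matrix

noncomputable section

/-- Computational basis labels of `k` qubits; the Hilbert space `(ℂ²)^{⊗ k}` is `Config k → ℂ`. -/
abbrev Config (k : ℕ) : Type := Fin k → Fin 2

/-- Two-qubit gates: the unitary group `U(4)`. One-qubit gates are the elements `u ⊗ 1`. -/
abbrev TwoQubitGate : Type := Matrix.unitaryGroup (Config 2) ℂ

/-! ### States, partial traces and the trace distance -/

/-- The density matrix `|ψ⟩⟨ψ|`. -/
def pureDensity {N : ℕ} (ψ : Config N → ℂ) : Matrix (Config N) (Config N) ℂ :=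
  Matrix.vecMulVec ψ (star ψ)

/-- The product state `|0 ⋯ 0⟩` on `N` qubits. -/
def zeroKet (N : ℕ) : Config N → ℂ :=
  Pi.single 0 1

/-- The maximally mixed state `𝕀 / 2^k` on `k` qubits. -/
def maximallyMixed (k : ℕ) : Matrix (Config k) (Config k) ℂ :=
  ((2 : ℂ) ^ k)⁻¹ • 1

open Classical in
/-- The reduced state on the qubits `e 0, …, e (k-1)`: the partial trace of `ρ` over all
qubits outside the range of `e`. -/
def reducedState {N k : ℕ} (e : Fin k ↪ Fin N) (ρ : Matrix (Config N) (Config N) ℂ) :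
    Matrix (Config k) (Config k) ℂ :=
  fun x y => ∑ z : Config N, ∑ w : Config N,
    if z ∘ e = x ∧ w ∘ e = y ∧ ∀ i, i ∉ Set.range e → z i = w i then ρ z w else 0

/-- The Schatten 1-norm: the sum of the singular values, i.e. of the square roots of the
eigenvalues of `Xᴴ X`. -/
def traceNorm {ι : Type*} [Fintype ι] [DecidableEq ι] (X : Matrix ι ι ℂ) : ℝ :=
  ∑ i, Real.sqrt ((Matrix.isHermitian_conjTranspose_mul_self X).eigenvalues i)

/-- The trace distance `‖ρ - σ‖₁ / 2`. -/
def traceDist {ι : Type*} [Fintype ι] [DecidableEq ι] (ρ σ : Matrix ι ι ℂ) : ℝ :=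
  traceNorm (ρ - σ) / 2

/-! ### Circuits over a gate set and mixed state complexity -/

open Classical in
/-- The operator on `N` qubits that acts as `u` on the qubits `e 0, …, e (k-1)` (in this order)
and as the identity on all other qubits. -/
def embedGate {N k : ℕ} (e : Fin k ↪ Fin N) (u : Matrix (Config k) (Config k) ℂ) :
    Matrix (Config N) (Config N) ℂ :=
  fun z w => if ∀ i, i ∉ Set.range e → z i = w i then u (z ∘ e) (w ∘ e) else 0

/-- `IsCircuit G N r U`: the operator `U` on `N` qubits is a product of `r` gates from `G`, each
applied to some ordered pair of distinct qubits. -/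
inductive IsCircuit (G : Set TwoQubitGate) (N : ℕ) : ℕ → Matrix (Config N) (Config N) ℂ → Prop
  | nil : IsCircuit G N 0 1
  | cons {r : ℕ} {U : Matrix (Config N) (Config N) ℂ} (g : TwoQubitGate) (hg : g ∈ G)
      (e : Fin 2 ↪ Fin N) (hU : IsCircuit G N r U) :
      IsCircuit G N (r + 1) (embedGate e (g : Matrix (Config 2) (Config 2) ℂ) * U)

/-- The `δ`-mixed state complexity of a `k`-qubit state `ρ` over the gate set `G`, with a register
of `N` qubits (system qubits and ancillas) initialized in `|0 ⋯ 0⟩`: the least `r` such that some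
circuit of `r` gates produces a state of the register whose reduced state on some `k` of the
qubits is within trace distance `δ` of `ρ`; it is `⊤` if there is no such circuit. -/
def mixedComplexity (G : Set TwoQubitGate) (N : ℕ) (δ : ℝ) {k : ℕ}
    (ρ : Matrix (Config k) (Config k) ℂ) : ℕ∞ :=
  sInf {s : ℕ∞ | ∃ r : ℕ, s = (r : ℕ∞) ∧ ∃ U : Matrix (Config N) (Config N) ℂ, IsCircuit G N r U ∧
    ∃ e : Fin k ↪ Fin N, traceDist ρ (reducedState e (pureDensity (U *ᵥ zeroKet N))) ≤ δ}

/-- Some circuit over `G` on two qubits turns `|00⟩` into a maximally entangled (EPR) pair, i.e.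
into a state with maximally mixed one-qubit marginal. -/
def PreparesEPR (G : Set TwoQubitGate) : Prop :=
  ∃ (r : ℕ) (U : Matrix (Config 2) (Config 2) ℂ), IsCircuit G 2 r U ∧
    ∃ e : Fin 1 ↪ Fin 2, reducedState e (pureDensity (U *ᵥ zeroKet 2)) = maximallyMixed 1

/-! ### Haar-random gates and brickwork circuits -/

instance TwoQubitGate.instCompactSpace : CompactSpace TwoQubitGate := by
  have hc : IsCompact (Set.univ.pi fun _ : Config 2 => Set.univ.pi fun _ : Config 2 =>
      Metric.closedBall (0 : ℂ) 1) :=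
    isCompact_univ_pi fun _ => isCompact_univ_pi fun _ => isCompact_closedBall 0 1
  have hcl : IsClosed (Matrix.unitaryGroup (Config 2) ℂ : Set (Matrix (Config 2) (Config 2) ℂ)) :=
    isClosed_unitary
  refine isCompact_iff_compactSpace.mp (hc.of_isClosed_subset hcl ?_)
  intro U hU i _ j _
  simpa using entry_norm_bound_of_unitary hU i j

instance TwoQubitGate.instMeasurableSpace : MeasurableSpace TwoQubitGate := borel _

instance TwoQubitGate.instBorelSpace : BorelSpace TwoQubitGate := ⟨rfl⟩

/-- The Haar probability measure on `U(4)`. -/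
def haarGate : Measure TwoQubitGate :=
  Measure.haarMeasure ⊤

/-- The neighbouring qubits `(2j + s, 2j + 1 + s)`, modulo `2m`, on which the `j`-th gate of
layer `s` (layers counted from `0`) acts, where `s` is taken modulo `2`. The first layer acts on
`(0,1), (2,3), …, (2m-2,2m-1)`, the second one on `(1,2), …, (2m-3,2m-2), (2m-1,0)`. -/
def brickPair {m : ℕ} (s : ℕ) (j : Fin m) : Fin 2 ↪ Fin (2 * m) where
  toFun b := ⟨(2 * (j : ℕ) + s % 2 + b) % (2 * m), Nat.mod_lt _ (by have := j.isLt; omega)⟩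
  inj' := by
    have hj := j.isLt
    have hs : s % 2 < 2 := Nat.mod_lt _ (by norm_num)
    have key : ∀ k : ℕ, k < 2 * m → (k + 0) % (2 * m) ≠ (k + 1) % (2 * m) := by
      intro k hk h
      rw [Nat.add_zero, Nat.mod_eq_of_lt hk] at h
      rcases Nat.lt_or_ge (k + 1) (2 * m) with h1 | h1
      · rw [Nat.mod_eq_of_lt h1] at h
        omega
      · have h2 : k + 1 = 2 * m := by omega
        rw [h2, Nat.mod_self] at h
        omega
    have key' := key (2 * (j : ℕ) + s % 2) (by omega)
    intro b b' h
    have h' := congrArg Fin.val h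
    fin_cases b <;> fin_cases b'
    · rfl
    · exact absurd h' key'
    · exact absurd h'.symm key'
    · rfl

/-- The unitary of one brickwork layer: the product of its `m` commuting two-qubit gates. -/
def brickLayer {m : ℕ} (s : ℕ) (u : Fin m → TwoQubitGate) :
    Matrix (Config (2 * m)) (Config (2 * m)) ℂ :=
  ((List.finRange m).map fun j =>
    embedGate (brickPair s j) (u j : Matrix (Config 2) (Config 2) ℂ)).prod

/-- The unitary `L_{t-1} ⋯ L_1 L_0` of the depth-`t` brickwork circuit on `2m` qubits with periodic
boundary conditions and gates `u s j` (gate `j` of layer `s`). -/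
def brickCircuit {m t : ℕ} (u : Fin t → Fin m → TwoQubitGate) :
    Matrix (Config (2 * m)) (Config (2 * m)) ℂ :=
  ((List.finRange t).map fun s : Fin t => brickLayer (s : ℕ) (u s)).reverse.prod

/-- The law of the gates of a depth-`t` brickwork random quantum circuit on `2m` qubits:
independent Haar-random two-qubit gates. -/
def brickMeasure (m t : ℕ) : Measure (Fin t → Fin m → TwoQubitGate) :=
  Measure.pi fun _ => Measure.pi fun _ => haarGate

/-- The qubits `e 0, e 1, …` form a contiguous block on the ring of `N` qubits. -/
def IsContiguous {N k : ℕ} (e : Fin k ↪ Fin N) : Prop :=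
  ∃ a : ℕ, ∀ i : Fin k, (e i : ℕ) = (a + i) % N

/-- The reduced state `ρ_A` of the output of the circuit with gates `u` and input `ψ`, where `A`
consists of the qubits `e 0, e 1, …`. -/
def brickOutput {m t nA : ℕ} (e : Fin nA ↪ Fin (2 * m)) (ψ : Config (2 * m) → ℂ)
    (u : Fin t → Fin m → TwoQubitGate) : Matrix (Config nA) (Config nA) ℂ :=
  reducedState e (pureDensity (brickCircuit u *ᵥ ψ))

end

/-! The output state is controlled through the mean purities of its marginals. Averaging over a Haar
gate on a pair of qubits fixes the purity of `S` if `S` contains both or neither of them; otherwise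
it gives 2/5 of the sum of the purities of `S` with the pair added and with the pair removed
(`integral_purity_embedGate`). Averaging over the circuit is thus a linear evolution of functions of
subsets, for which 2^(-|S|) + 2^(-|Sᶜ|) is stationary. The bound on the excess over it decays
uniformly in the number of qubits. A layer that splits `S` passes the excess on with total weight at
most 4/5, and a set split by neither of two consecutive layers is empty or everything, where the
purity is at most 1 and the stationary value at least 1. So after t + 1 layers the excess is at most
(4/5)^t (`meanPurity_succ_le_add`).

Since ‖X‖₁² ≤ D_A ‖X‖₂², the squared trace distance of ρ_A from the maximally mixed state is at most
(D_A tr ρ_A² - 1)/4, whose mean is at most (D_A/D_B + D_A (4/5)^t)/4. Markov's inequality makes it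
small at depth linear in n_A (`brickMeasure_traceDist_gt_le`). The sandwich of complexities is then
the triangle inequality, and the linear bound comes from n_A EPR pairs of which one half each is
discarded.

For the exact equality, the complexity of the maximally mixed state is a nonincreasing step function
of δ, at most K n_A for δ ≥ 0. The sandwich collapses once δ is farther from its K n_A + 1
thresholds than the trace distance. By a Borel-Cantelli argument (`ae_exists_forall_mul_lt_dist`)
almost every δ avoids countably many thresholds by a fixed multiple of any summable radii. The two
errors need two families. The error D_A/D_B = 2^(-d), d = n_B - n_A, becomes summable over (n_A, d)
thanks to the factor (n_A + 1)^5. The depth error does not decay in d; but s gates touch at most 2s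
qubits, so a threshold no longer depends on the register once that has n_A + 2s qubits. This leaves
finitely many thresholds per n_A, and radii 2^(-n_A) suffice. -/

noncomputable section

/-! ### Splitting the register -/

/-- Configurations of the qubits outside the range of `e`. -/
abbrev RestConfig {N k : ℕ} (e : Fin k ↪ Fin N) : Type := {i // i ∉ Set.range e} → Fin 2

open Classical in
instance {N k : ℕ} (e : Fin k ↪ Fin N) : Fintype {i // i ∉ Set.range e} :=
  Subtype.fintype _

open Classical in
/-- The configuration that is `a` on the range of `e` and `r` outside. -/
def joinConfig {N k : ℕ} (e : Fin k ↪ Fin N) (a : Config k) (r : RestConfig e) : Config N :=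
  fun i => if h : i ∈ Set.range e then a h.choose else r ⟨i, h⟩

variable {N k : ℕ} (e : Fin k ↪ Fin N)

@[simp] lemma joinConfig_apply_emb (a : Config k) (r : RestConfig e) (j : Fin k) :
    joinConfig e a r (e j) = a j := by
  have h : e j ∈ Set.range e := ⟨j, rfl⟩
  simp only [joinConfig, dif_pos h]
  exact congrArg a (e.injective h.choose_spec)

@[simp] lemma joinConfig_comp (a : Config k) (r : RestConfig e) :
    joinConfig e a r ∘ e = a :=
  funext fun j => joinConfig_apply_emb e a r j

lemma joinConfig_apply_of_notMem (a : Config k) (r : RestConfig e) {i : Fin N}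
    (h : i ∉ Set.range e) : joinConfig e a r i = r ⟨i, h⟩ :=
  dif_neg h

lemma joinConfig_ext {z w : Config N} (h₁ : ∀ j, z (e j) = w (e j))
    (h₂ : ∀ i, i ∉ Set.range e → z i = w i) : z = w := by
  funext i
  by_cases h : i ∈ Set.range e
  · obtain ⟨j, rfl⟩ := h
    exact h₁ j
  · exact h₂ i h

/-- A configuration of all qubits is a pair of configurations inside and outside the range. -/
def splitEquiv : Config N ≃ Config k × RestConfig e where
  toFun z := (z ∘ e, fun i => z i)
  invFun p := joinConfig e p.1 p.2
  left_inv z := joinConfig_ext e (fun j => by simp)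
    (fun i h => by simp [joinConfig_apply_of_notMem e _ _ h])
  right_inv p := by
    refine Prod.ext (joinConfig_comp e _ _) (funext fun i => ?_)
    exact joinConfig_apply_of_notMem e _ _ i.2

lemma sum_joinConfig {M : Type*} [AddCommMonoid M] (f : Config N → M) :
    ∑ z, f z = ∑ a : Config k, ∑ r : RestConfig e, f (joinConfig e a r) := by
  rw [← (splitEquiv e).symm.sum_comp f, Fintype.sum_prod_type]
  rfl

lemma joinConfig_agree_iff (a b : Config k) (r s : RestConfig e) :
    (∀ i, i ∉ Set.range e → joinConfig e a r i = joinConfig e b s i) ↔ r = s := by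
  constructor
  · intro h
    funext i
    have := h i i.2
    rwa [joinConfig_apply_of_notMem e _ _ i.2, joinConfig_apply_of_notMem e _ _ i.2] at this
  · rintro rfl i h
    rw [joinConfig_apply_of_notMem e _ _ h, joinConfig_apply_of_notMem e _ _ h]

lemma embedGate_joinConfig (u : Matrix (Config k) (Config k) ℂ) (a b : Config k)
    (r s : RestConfig e) :
    embedGate e u (joinConfig e a r) (joinConfig e b s) = if r = s then u a b else 0 := by
  simp only [embedGate, joinConfig_agree_iff, joinConfig_comp]

lemma embedGate_mulVec_joinConfig (u : Matrix (Config k) (Config k) ℂ) (φ : Config N → ℂ)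
    (a : Config k) (r : RestConfig e) :
    (embedGate e u *ᵥ φ) (joinConfig e a r) = ∑ b, u a b * φ (joinConfig e b r) := by
  simp only [Matrix.mulVec, dotProduct]
  rw [sum_joinConfig e]
  simp [embedGate_joinConfig]

lemma reducedState_apply (ρ : Matrix (Config N) (Config N) ℂ) (x y : Config k) :
    reducedState e ρ x y = ∑ r : RestConfig e, ρ (joinConfig e x r) (joinConfig e y r) := by
  classical
  have hz : ∀ z, (∑ w : Config N, if z ∘ e = x ∧ w ∘ e = y ∧ ∀ i, i ∉ Set.range e → z i = w i
      then ρ z w else 0) = ∑ b, ∑ s, if z ∘ e = x ∧ (joinConfig e b s) ∘ e = y ∧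
        ∀ i, i ∉ Set.range e → z i = joinConfig e b s i then ρ z (joinConfig e b s) else 0 :=
    fun z => sum_joinConfig e _
  simp only [reducedState, hz]
  rw [sum_joinConfig e]
  simp only [joinConfig_agree_iff, joinConfig_comp, ite_and]
  simp

lemma reducedState_pureDensity (φ : Config N → ℂ) (x y : Config k) :
    reducedState e (pureDensity φ) x y =
      ∑ r : RestConfig e, φ (joinConfig e x r) * star (φ (joinConfig e y r)) := by
  simp [reducedState_apply, pureDensity, Matrix.vecMulVec_apply]

/-! ### Purity -/

/-- The purity `tr ρ_S²` of the marginal on the set `S` of the vector `φ`, as a complex number. -/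
def purityC {N : ℕ} (S : Finset (Fin N)) (φ : Config N → ℂ) : ℂ :=
  ∑ x : Config N, ∑ y : Config N,
    φ x * φ y * star (φ (S.piecewise y x)) * star (φ (S.piecewise x y))

/-- The purity `tr ρ_S²` of the marginal on the set `S` of the vector `φ`. -/
def purity {N : ℕ} (S : Finset (Fin N)) (φ : Config N → ℂ) : ℝ := (purityC S φ).re

/-- Exchange the configurations `r` and `s` on the qubits of `S` outside the range of `e`. -/
def restMix (S : Finset (Fin N)) (r s : RestConfig e) : RestConfig e :=
  fun i => if (i : Fin N) ∈ S then s i else r i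

lemma piecewise_joinConfig (S : Finset (Fin N)) (a b : Config k) (r s : RestConfig e) :
    S.piecewise (joinConfig e b s) (joinConfig e a r) =
      joinConfig e (fun j => if e j ∈ S then b j else a j) (restMix e S r s) := by
  refine joinConfig_ext e (fun j => ?_) (fun i h => ?_)
  · simp [Finset.piecewise]
  · simp [Finset.piecewise, joinConfig_apply_of_notMem e _ _ h, restMix]

/-- The tensor of local indices whose contractions are the purities. -/
def purityTensor (S : Finset (Fin N)) (φ : Config N → ℂ) (a b c d : Config k) : ℂ :=
  ∑ r : RestConfig e, ∑ s : RestConfig e, φ (joinConfig e a r) * φ (joinConfig e b s) *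
    star (φ (joinConfig e c (restMix e S r s))) * star (φ (joinConfig e d (restMix e S s r)))

lemma purityC_eq_tensor (S : Finset (Fin N)) (φ : Config N → ℂ) :
    purityC S φ = ∑ a : Config k, ∑ b : Config k, purityTensor e S φ a b
      (fun j => if e j ∈ S then b j else a j) (fun j => if e j ∈ S then a j else b j) := by
  simp only [purityC, purityTensor]
  rw [sum_joinConfig e]
  refine Finset.sum_congr rfl fun a _ => ?_
  rw [Finset.sum_comm]
  conv_lhs =>
    rw [Finset.sum_comm]
    enter [2, r]
    rw [sum_joinConfig e]
  rw [Finset.sum_comm]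
  simp only [piecewise_joinConfig]

/-- This is what makes the purities of `S`, `S ∪ {e 0, e 1}` and `S \ {e 0, e 1}` three contractions
of one and the same tensor. -/
lemma purityTensor_congr {S S' : Finset (Fin N)} (h : ∀ i, i ∉ Set.range e → (i ∈ S ↔ i ∈ S'))
    (φ : Config N → ℂ) : purityTensor e S φ = purityTensor e S' φ := by
  have : restMix e S = restMix e S' := by
    funext r s i
    simp [restMix, h i i.2]
  funext a b c d
  simp [purityTensor, this]

/-- The action of `g ⊗ g ⊗ ḡ ⊗ ḡ` on tensors. -/
def tensorAct {ι : Type*} [Fintype ι] (g : Matrix ι ι ℂ) (V : ι → ι → ι → ι → ℂ) (a b c d : ι) :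
    ℂ :=
  ∑ a', g a a' * ∑ b', g b b' * ∑ c', star (g c c') * ∑ d', star (g d d') * V a' b' c' d'

lemma tensorAct_sum {ι κ : Type*} [Fintype ι] (t : Finset κ) (g : Matrix ι ι ℂ)
    (V : κ → ι → ι → ι → ι → ℂ) (a b c d : ι) :
    tensorAct g (fun a b c d => ∑ r ∈ t, V r a b c d) a b c d = ∑ r ∈ t, tensorAct g (V r) a b c d := by
  simp only [tensorAct, Finset.mul_sum]
  symm
  iterate 3
    rw [Finset.sum_comm]
    refine Finset.sum_congr rfl fun _ _ => ?_
  rw [Finset.sum_comm]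

lemma tensorAct_mul_vec {ι : Type*} [Fintype ι] (g : Matrix ι ι ℂ) (A B C D : ι → ℂ)
    (a b c d : ι) :
    tensorAct g (fun a b c d => A a * B b * star (C c) * star (D d)) a b c d =
      (∑ a', g a a' * A a') * (∑ b', g b b' * B b') * star (∑ c', g c c' * C c') *
        star (∑ d', g d d' * D d') := by
  have h : ∀ a' b' c' d', star (g d d') * (A a' * B b' * star (C c') * star (D d')) =
      A a' * B b' * star (C c') * (star (g d d') * star (D d')) := by
    intros; ring
  have h2 : ∀ a' b' c' X, star (g c c') * (A a' * B b' * star (C c') * X) =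
      A a' * B b' * X * (star (g c c') * star (C c')) := by
    intros; ring
  have h3 : ∀ a' b' X Y, g b b' * (A a' * B b' * X * Y) = A a' * X * Y * (g b b' * B b') := by
    intros; ring
  have h4 : ∀ a' X Y Z, g a a' * (A a' * X * Y * Z) = X * Y * Z * (g a a' * A a') := by
    intros; ring
  simp only [tensorAct, h, ← Finset.mul_sum, h2, h3, h4, star_sum, star_mul']
  ring

/-- The gate moves only the indices inside the range of `e`, and `restMix` only those outside, so
the gate acts separately on the four copies of the state. -/
lemma purityTensor_embedGate (S : Finset (Fin N)) (φ : Config N → ℂ)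
    (u : Matrix (Config k) (Config k) ℂ) :
    purityTensor e S (embedGate e u *ᵥ φ) = tensorAct u (purityTensor e S φ) := by
  funext a b c d
  unfold purityTensor
  simp only [embedGate_mulVec_joinConfig, tensorAct_sum]
  refine Finset.sum_congr rfl fun r _ => Finset.sum_congr rfl fun s _ => ?_
  rw [tensorAct_mul_vec u (fun a => φ (joinConfig e a r)) (fun b => φ (joinConfig e b s))
    (fun c => φ (joinConfig e c (restMix e S r s))) (fun d => φ (joinConfig e d (restMix e S s r)))]

lemma piecewise_swap_swap {N : ℕ} (S : Finset (Fin N)) (x y : Config N) :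
    S.piecewise (S.piecewise x y) (S.piecewise y x) = x := by
  funext i
  by_cases h : i ∈ S <;> simp [h]

/-- Exchanging two configurations on `S`. -/
def swapOn {N : ℕ} (S : Finset (Fin N)) : Config N × Config N ≃ Config N × Config N where
  toFun p := (S.piecewise p.2 p.1, S.piecewise p.1 p.2)
  invFun p := (S.piecewise p.2 p.1, S.piecewise p.1 p.2)
  left_inv _ := Prod.ext (piecewise_swap_swap S _ _) (piecewise_swap_swap S _ _)
  right_inv _ := Prod.ext (piecewise_swap_swap S _ _) (piecewise_swap_swap S _ _)

/-- Cauchy-Schwarz in the form 2ab ≤ a² + b²: exchanging two configurations on `S` is a bijection of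
pairs, so both squares have the same sum. -/
lemma purity_le (S : Finset (Fin N)) (φ : Config N → ℂ) :
    purity S φ ≤ (∑ x, ‖φ x‖ ^ 2) ^ 2 := by
  let F : Config N × Config N → ℝ := fun p => ‖φ p.1‖ ^ 2 * ‖φ p.2‖ ^ 2
  have hF : ∑ p, F p = (∑ x, ‖φ x‖ ^ 2) ^ 2 := by
    rw [sq, Finset.sum_mul_sum, Fintype.sum_prod_type]
  have hF' : ∑ p, F (swapOn S p) = (∑ x, ‖φ x‖ ^ 2) ^ 2 := by
    rw [← hF]; exact (swapOn S).sum_comp F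
  have hle : ∀ p : Config N × Config N, (φ p.1 * φ p.2 * star (φ (S.piecewise p.2 p.1)) *
      star (φ (S.piecewise p.1 p.2))).re ≤ (F p + F (swapOn S p)) / 2 := by
    intro p
    refine (Complex.re_le_norm _).trans ?_
    simp only [norm_mul, norm_star, F, swapOn, Equiv.coe_fn_mk]
    nlinarith [sq_nonneg (‖φ p.1‖ * ‖φ p.2‖ -
      ‖φ (S.piecewise p.2 p.1)‖ * ‖φ (S.piecewise p.1 p.2)‖)]
  have hp : purity S φ = ∑ p : Config N × Config N, (φ p.1 * φ p.2 *
      star (φ (S.piecewise p.2 p.1)) * star (φ (S.piecewise p.1 p.2))).re := by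
    rw [Fintype.sum_prod_type]
    simp [purity, purityC]
  rw [hp]
  refine (Finset.sum_le_sum fun p _ => hle p).trans ?_
  rw [← Finset.sum_div, Finset.sum_add_distrib, hF, hF']
  linarith

lemma purity_empty (φ : Config N → ℂ) : purity ∅ φ = (∑ x, ‖φ x‖ ^ 2) ^ 2 := by
  have : purityC ∅ φ = (((∑ x, ‖φ x‖ ^ 2) ^ 2 : ℝ) : ℂ) := by
    have h : ∀ x y, φ x * φ y * star (φ x) * star (φ y) =
        ((‖φ x‖ ^ 2 : ℝ) : ℂ) * ((‖φ y‖ ^ 2 : ℝ) : ℂ) := by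
      intro x y
      simp only [Complex.ofReal_pow, ← Complex.mul_conj']
      simp only [starRingEnd_apply]
      ring
    simp only [purityC, Finset.piecewise_empty, h]
    rw [← Finset.sum_mul_sum, sq]
    push_cast
    rfl
  rw [purity, this, Complex.ofReal_re]

lemma purity_map_univ (φ : Config N → ℂ) :
    purity (Finset.univ.map e) φ = ∑ x, ∑ y, ‖reducedState e (pureDensity φ) x y‖ ^ 2 := by
  have hm : ∀ r s : RestConfig e, restMix e (Finset.univ.map e) r s = r := by
    intro r s
    funext i
    have : (i : Fin N) ∉ Finset.univ.map e := by
      intro h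
      obtain ⟨j, -, hj⟩ := Finset.mem_map.mp h
      exact i.2 ⟨j, hj⟩
    simp only [restMix, if_neg this]
  have : purityC (Finset.univ.map e) φ =
      ((∑ x, ∑ y, ‖reducedState e (pureDensity φ) x y‖ ^ 2 : ℝ) : ℂ) := by
    rw [purityC_eq_tensor e]
    push_cast
    refine Finset.sum_congr rfl fun a _ => Finset.sum_congr rfl fun b _ => ?_
    rw [← Complex.mul_conj', reducedState_pureDensity, map_sum, Finset.sum_mul_sum]
    simp only [purityTensor, hm, Finset.mem_map', Finset.mem_univ, if_true]
    refine Finset.sum_congr rfl fun r _ => Finset.sum_congr rfl fun s _ => ?_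
    simp only [starRingEnd_apply, star_mul', star_star]
    ring
  rw [purity, this, Complex.ofReal_re]

end

/-! ### Second moments of a Haar-random two-qubit gate. -/

noncomputable section

/-! ### Tensors invariant under `g ⊗ g ⊗ ḡ ⊗ ḡ` -/

section Twirl

variable {ι : Type*} [Fintype ι] [DecidableEq ι]

/-- Invariance of a tensor under all `g ⊗ g ⊗ ḡ ⊗ ḡ`. -/
def TwirlInvariant (V : ι → ι → ι → ι → ℂ) : Prop :=
  ∀ g ∈ Matrix.unitaryGroup ι ℂ, tensorAct g V = V

/-- The permutation matrix of `σ` with phases `p`. -/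
def monomialMatrix (σ : Equiv.Perm ι) (p : ι → ℂ) : Matrix ι ι ℂ :=
  fun x y => if σ x = y then p x else 0

lemma monomialMatrix_mem (σ : Equiv.Perm ι) (p : ι → ℂ) (hp : ∀ x, p x * star (p x) = 1) :
    monomialMatrix σ p ∈ Matrix.unitaryGroup ι ℂ := by
  rw [Matrix.mem_unitaryGroup_iff]
  ext x y
  simp only [Matrix.mul_apply, Matrix.star_apply, monomialMatrix, Matrix.one_apply]
  by_cases h : x = y
  · subst h
    simpa [apply_ite] using hp x
  · have : σ y ≠ σ x := fun h' => h (σ.injective h'.symm)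
    simp [h, this]

lemma tensorAct_monomialMatrix (σ : Equiv.Perm ι) (p : ι → ℂ) (V : ι → ι → ι → ι → ℂ)
    (a b c d : ι) : tensorAct (monomialMatrix σ p) V a b c d =
      p a * p b * star (p c) * star (p d) * V (σ a) (σ b) (σ c) (σ d) := by
  simp only [tensorAct, monomialMatrix, apply_ite star, star_zero, ite_mul, zero_mul,
    Finset.sum_ite_eq, Finset.mem_univ, if_true]
  ring

variable {V : ι → ι → ι → ι → ℂ}

lemma TwirlInvariant.perm (hV : TwirlInvariant V) (σ : Equiv.Perm ι) (a b c d : ι) :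
    V (σ a) (σ b) (σ c) (σ d) = V a b c d := by
  have h := congrFun (congrFun (congrFun (congrFun
    (hV _ (monomialMatrix_mem σ (fun _ => 1) (by simp))) a) b) c) d
  rw [tensorAct_monomialMatrix] at h
  simpa using h

/-- Putting the phase i on the basis vector x multiplies the entry by i to the power [a = x] + [b =
x] - [c = x] - [d = x]. This exponent lies between -2 and 2, so the factor is 1 only if the exponent
vanishes; the phase -1 would not detect ±2. -/
lemma TwirlInvariant.eq_zero (hV : TwirlInvariant V) {a b c d : ι}
    (h : ¬ ((a = c ∧ b = d) ∨ (a = d ∧ b = c))) : V a b c d = 0 := by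
  have key : ∀ x : ι, ((if a = x then Complex.I else 1) * (if b = x then Complex.I else 1) *
      star (if c = x then Complex.I else 1 : ℂ) * star (if d = x then Complex.I else 1 : ℂ)) *
        V a b c d = V a b c d := by
    intro x
    have h := congrFun (congrFun (congrFun (congrFun
      (hV _ (monomialMatrix_mem (Equiv.refl ι) (fun y => if y = x then Complex.I else 1) (by
        intro y; split_ifs <;> simp))) a) b) c) d
    rw [tensorAct_monomialMatrix] at h
    exact h
  by_contra hne
  have key' : ∀ x : ι, ((if a = x then Complex.I else 1) * (if b = x then Complex.I else 1) *
      star (if c = x then Complex.I else 1 : ℂ) * star (if d = x then Complex.I else 1 : ℂ)) = 1 :=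
    fun x => mul_right_cancel₀ hne ((key x).trans (one_mul _).symm)
  -- The tests x = a and x = b already force {a, b} = {c, d} as multisets.
  have ha := key' a
  have hb := key' b
  clear key key' hne hV
  by_cases hab : b = a
  · subst hab
    by_cases hcb : c = b <;> by_cases hdb : d = b <;>
      simp_all [Complex.ext_iff]; norm_num at ha
  · have hba : ¬ a = b := fun h => hab h.symm
    by_cases hca : c = a
    · subst hca
      have hdb : ¬ d = b := fun h' => h (Or.inl ⟨rfl, h'.symm⟩)
      simp [hba, hdb, Complex.ext_iff] at hb
    · by_cases hda : d = a
      · subst hda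
        have hcb : ¬ c = b := fun h' => h (Or.inr ⟨rfl, h'.symm⟩)
        simp [hba, hcb, Complex.ext_iff] at hb
      · simp [hab, hca, hda, Complex.ext_iff] at ha

/-- The reflection that maps `a` to `(-3 a + 4 b) / 5`. -/
def planeReflection (a b : ι) : Matrix ι ι ℂ :=
  1 - (2 / 5 : ℂ) • Matrix.vecMulVec (fun x => if x = a then 2 else if x = b then -1 else 0)
    (fun x => if x = a then 2 else if x = b then -1 else 0)

lemma planeReflection_mem {a b : ι} (h : a ≠ b) :
    planeReflection a b ∈ Matrix.unitaryGroup ι ℂ := by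
  rw [Matrix.mem_unitaryGroup_iff]
  set v : ι → ℂ := fun x => if x = a then 2 else if x = b then -1 else 0 with hv
  have hstar : star v = v := by
    funext x
    simp only [hv, Pi.star_apply]
    split_ifs <;> simp
  have hvv : v ⬝ᵥ v = 5 := by
    have : ∀ x, v x * v x = (if x = a then 4 else 0) + (if x = b then 1 else 0) := by
      intro x
      simp only [hv]
      by_cases hxa : x = a
      · subst hxa; simp [h]; norm_num
      · by_cases hxb : x = b
        · subst hxb; simp [h.symm]
        · simp [hxa, hxb]
    simp only [dotProduct, this, Finset.sum_add_distrib]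
    simp; norm_num
  have hs : star (planeReflection a b) = planeReflection a b := by
    simp only [planeReflection, ← hv, Matrix.star_eq_conjTranspose, Matrix.conjTranspose_sub,
      Matrix.conjTranspose_one, Matrix.conjTranspose_smul, Matrix.conjTranspose_vecMulVec, hstar]
    norm_num
  rw [hs]
  simp only [planeReflection, ← hv, sub_mul, mul_sub, one_mul, mul_one, smul_mul_assoc,
    mul_smul_comm, Matrix.vecMulVec_mul_vecMulVec, hvv]
  ext x y
  simp [Matrix.vecMulVec_apply]
  ring

lemma planeReflection_row {a b : ι} (h : a ≠ b) (f : ι → ℂ) :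
    ∑ x, planeReflection a b a x * f x = -3 / 5 * f a + 4 / 5 * f b := by
  have : ∀ x, planeReflection a b a x * f x =
      (if x = a then -3 / 5 * f a else 0) + (if x = b then 4 / 5 * f b else 0) := by
    intro x
    simp only [planeReflection, Matrix.sub_apply, Matrix.one_apply, Matrix.smul_apply,
      Matrix.vecMulVec_apply, if_true, smul_eq_mul]
    by_cases hxa : x = a
    · subst hxa; simp [h]; left; norm_num
    · by_cases hxb : x = b
      · subst hxb; simp [h, hxa]; left; norm_num
      · simp [hxa, hxb, Ne.symm hxa]
  simp [this, Finset.sum_add_distrib]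

lemma planeReflection_row_star {a b : ι} (h : a ≠ b) (f : ι → ℂ) :
    ∑ x, star (planeReflection a b a x) * f x = -3 / 5 * f a + 4 / 5 * f b := by
  rw [← planeReflection_row h]
  refine Finset.sum_congr rfl fun x _ => ?_
  congr 1
  simp only [planeReflection, Matrix.sub_apply, Matrix.one_apply, Matrix.smul_apply,
      Matrix.vecMulVec_apply, if_true, smul_eq_mul]
  split_ifs <;> simp

/-- Permutations and phases cannot relate the diagonal entry to the others; a rotation mixing two
basis vectors is needed. The 3-4-5 reflection does this with rational entries. -/
lemma TwirlInvariant.diag (hV : TwirlInvariant V) {a b : ι} (h : a ≠ b) :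
    V a a a a = V a b a b + V a b b a := by
  have h1 := congrFun (congrFun (congrFun (congrFun (hV _ (planeReflection_mem h)) a) a) a) a
  simp only [tensorAct, planeReflection_row h, planeReflection_row_star h] at h1
  have z : ∀ {p q r s : ι}, ¬ ((p = r ∧ q = s) ∨ (p = s ∧ q = r)) → V p q r s = 0 :=
    fun h => hV.eq_zero h
  have hσ := hV.perm (Equiv.swap a b)
  have e1 := hσ a a a a
  have e2 := hσ a b a b
  have e3 := hσ a b b a
  simp only [Equiv.swap_apply_left, Equiv.swap_apply_right] at e1 e2 e3
  have h' : b ≠ a := h.symm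
  rw [z (p := a) (q := a) (r := a) (s := b) (by tauto),
    z (p := a) (q := a) (r := b) (s := a) (by tauto),
    z (p := a) (q := a) (r := b) (s := b) (by tauto),
    z (p := a) (q := b) (r := a) (s := a) (by tauto),
    z (p := a) (q := b) (r := b) (s := b) (by tauto),
    z (p := b) (q := a) (r := a) (s := a) (by tauto),
    z (p := b) (q := a) (r := b) (s := b) (by tauto),
    z (p := b) (q := b) (r := a) (s := a) (by tauto),
    z (p := b) (q := b) (r := a) (s := b) (by tauto),
    z (p := b) (q := b) (r := b) (s := a) (by tauto), e1, e2, e3] at h1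
  -- The diagonal entries come with (3/5)^4 + (4/5)^4 = 337/625 and the mixed ones with 2 · 144/625
  -- each; 625 - 337 = 288.
  linear_combination (-625 / 288 : ℂ) * h1

/-- An invariant tensor is determined by two numbers. -/
lemma TwirlInvariant.exists_eq (hV : TwirlInvariant V) {x y : ι} (hxy : x ≠ y) :
    ∃ A B : ℂ, ∀ a b c d, V a b c d =
      (if a = c ∧ b = d then A else 0) + (if a = d ∧ b = c then B else 0) := by
  have hperm : ∀ {a b : ι}, a ≠ b → ∃ σ : Equiv.Perm ι, σ x = a ∧ σ y = b := by
    intro a b hab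
    refine ⟨(Equiv.swap x a).trans (Equiv.swap (Equiv.swap x a y) b), ?_, ?_⟩
    · simp only [Equiv.trans_apply, Equiv.swap_apply_left]
      refine Equiv.swap_apply_of_ne_of_ne (fun h => hxy ?_) hab
      have := congrArg (Equiv.swap x a) h
      simpa using this
    · simp
  have hA : ∀ {a b : ι}, a ≠ b → V a b a b = V x y x y ∧ V a b b a = V x y y x := by
    intro a b hab
    obtain ⟨σ, h1, h2⟩ := hperm hab
    rw [← h1, ← h2]
    exact ⟨hV.perm σ _ _ _ _, hV.perm σ _ _ _ _⟩
  refine ⟨V x y x y, V x y y x, fun a b c d => ?_⟩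
  by_cases h1 : a = c ∧ b = d
  · obtain ⟨rfl, rfl⟩ := h1
    by_cases h2 : a = b
    · subst h2
      obtain ⟨b, hb⟩ : ∃ b, a ≠ b := by
        by_cases h : a = x
        · exact ⟨y, h ▸ hxy⟩
        · exact ⟨x, h⟩
      simp [hV.diag hb, hA hb]
    · simp [h2, hA h2]
  · by_cases h2 : a = d ∧ b = c
    · obtain ⟨rfl, rfl⟩ := h2
      have h3 : a ≠ b := by
        rintro rfl
        exact h1 ⟨rfl, rfl⟩
      simp [h3, hA h3]
    · rw [if_neg h1, if_neg h2, hV.eq_zero (by tauto), add_zero]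

/-- Reduces identities that are linear in the tensor to product tensors, where the gate acts on four
separate vectors. -/
lemma exists_eq_sum_products (V : ι → ι → ι → ι → ℂ) :
    ∃ A B C D : ι × ι × ι × ι → ι → ℂ, V = fun a b c d =>
      ∑ q, A q a * B q b * star (C q c) * star (D q d) := by
  refine ⟨fun q a => if a = q.1 then V q.1 q.2.1 q.2.2.1 q.2.2.2 else 0,
    fun q b => if b = q.2.1 then 1 else 0, fun q c => if c = q.2.2.1 then 1 else 0,
    fun q d => if d = q.2.2.2 then 1 else 0, ?_⟩
  funext a b c d
  simp only [Fintype.sum_prod_type, apply_ite star, star_one, star_zero, mul_ite, mul_one, mul_zero,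
    Finset.sum_ite_eq, Finset.mem_univ, if_true]

omit [DecidableEq ι] in
lemma tensorAct_mulVec (g : Matrix ι ι ℂ) (A B C D : ι → ℂ) (a b c d : ι) :
    tensorAct g (fun a b c d => A a * B b * star (C c) * star (D d)) a b c d =
      (g *ᵥ A) a * (g *ᵥ B) b * star ((g *ᵥ C) c) * star ((g *ᵥ D) d) :=
  tensorAct_mul_vec g A B C D a b c d

lemma star_mulVec_dotProduct_mulVec {g : Matrix ι ι ℂ} (hg : g ∈ Matrix.unitaryGroup ι ℂ)
    (A C : ι → ℂ) : ∑ a, (g *ᵥ A) a * star ((g *ᵥ C) a) = ∑ a, A a * star (C a) := by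
  have h : (g *ᵥ A) ⬝ᵥ star (g *ᵥ C) = A ⬝ᵥ star C := by
    rw [dotProduct_comm, Matrix.star_mulVec, ← Matrix.dotProduct_mulVec, Matrix.mulVec_mulVec,
      ← Matrix.star_eq_conjTranspose, Matrix.mem_unitaryGroup_iff'.mp hg, Matrix.one_mulVec,
      dotProduct_comm]
  exact h

lemma tensorAct_contract_parallel {g : Matrix ι ι ℂ} (hg : g ∈ Matrix.unitaryGroup ι ℂ)
    (V : ι → ι → ι → ι → ℂ) :
    ∑ a, ∑ b, tensorAct g V a b a b = ∑ a, ∑ b, V a b a b := by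
  have key : ∀ A B C D : ι → ℂ, ∑ a, ∑ b, A a * B b * star (C a) * star (D b) =
      (∑ a, A a * star (C a)) * ∑ b, B b * star (D b) := by
    intro A B C D
    rw [Finset.sum_mul_sum]
    exact Finset.sum_congr rfl fun _ _ => Finset.sum_congr rfl fun _ _ => by ring
  obtain ⟨A, B, C, D, rfl⟩ := exists_eq_sum_products V
  simp only [tensorAct_sum, tensorAct_mulVec]
  simp only [Finset.sum_comm (s := Finset.univ (α := ι)) (t := Finset.univ (α := ι × ι × ι × ι)),
    key, star_mulVec_dotProduct_mulVec hg]

lemma tensorAct_contract_crossed {g : Matrix ι ι ℂ} (hg : g ∈ Matrix.unitaryGroup ι ℂ)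
    (V : ι → ι → ι → ι → ℂ) :
    ∑ a, ∑ b, tensorAct g V a b b a = ∑ a, ∑ b, V a b b a := by
  have key : ∀ A B C D : ι → ℂ, ∑ a, ∑ b, A a * B b * star (C b) * star (D a) =
      (∑ a, A a * star (D a)) * ∑ b, B b * star (C b) := by
    intro A B C D
    rw [Finset.sum_mul_sum]
    exact Finset.sum_congr rfl fun _ _ => Finset.sum_congr rfl fun _ _ => by ring
  obtain ⟨A, B, C, D, rfl⟩ := exists_eq_sum_products V
  simp only [tensorAct_sum, tensorAct_mulVec]
  simp only [Finset.sum_comm (s := Finset.univ (α := ι)) (t := Finset.univ (α := ι × ι × ι × ι)),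
    key, star_mulVec_dotProduct_mulVec hg]

lemma tensorAct_mul (g h : Matrix ι ι ℂ) (V : ι → ι → ι → ι → ℂ) :
    tensorAct (g * h) V = tensorAct g (tensorAct h V) := by
  obtain ⟨A, B, C, D, rfl⟩ := exists_eq_sum_products V
  funext a b c d
  have : tensorAct h (fun a b c d => ∑ q, A q a * B q b * star (C q c) * star (D q d)) =
      fun a b c d => ∑ q, (h *ᵥ A q) a * (h *ᵥ B q) b * star ((h *ᵥ C q) c) *
        star ((h *ᵥ D q) d) := by
    funext a b c d
    simp only [tensorAct_sum, tensorAct_mulVec]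
  rw [this]
  simp only [tensorAct_sum, tensorAct_mulVec, Matrix.mulVec_mulVec]

end Twirl

/-! ### The Haar average -/

instance : SecondCountableTopology TwoQubitGate := by
  have : SecondCountableTopology (Matrix (Config 2) (Config 2) ℂ) :=
    inferInstanceAs (SecondCountableTopology (Config 2 → Config 2 → ℂ))
  exact TopologicalSpace.Subtype.secondCountableTopology _

instance : IsProbabilityMeasure haarGate :=
  ⟨by
    rw [haarGate]
    simpa using Measure.haarMeasure_self (K₀ := (⊤ : TopologicalSpace.PositiveCompacts TwoQubitGate))⟩

instance : haarGate.IsMulLeftInvariant :=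
  inferInstanceAs (Measure.haarMeasure _).IsMulLeftInvariant

lemma continuous_gate_apply (a b : Config 2) : 
    Continuous fun u : TwoQubitGate => (u : Matrix (Config 2) (Config 2) ℂ) a b :=
  (continuous_subtype_val).matrix_elem a b

lemma continuous_tensorAct (G : Config 2 → Config 2 → Config 2 → Config 2 → ℂ)
    (a b c d : Config 2) : Continuous fun u : TwoQubitGate =>
      tensorAct (u : Matrix (Config 2) (Config 2) ℂ) G a b c d := by
  have h := continuous_gate_apply
  exact continuous_finsetSum _ fun a' _ => (h a a').mul <|
    continuous_finsetSum _ fun b' _ => (h b b').mul <|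
    continuous_finsetSum _ fun c' _ => (h c c').star.mul <|
    continuous_finsetSum _ fun d' _ => (h d d').star.mul continuous_const

lemma integrable_haarGate {f : TwoQubitGate → ℂ} (hf : Continuous f) : Integrable f haarGate :=
  hf.integrable_of_hasCompactSupport (HasCompactSupport.of_compactSpace f)

lemma integral_tensorAct (g : Matrix (Config 2) (Config 2) ℂ)
    {F : TwoQubitGate → Config 2 → Config 2 → Config 2 → Config 2 → ℂ}
    (hF : ∀ a b c d, Continuous fun u => F u a b c d) (a b c d : Config 2) :
    ∫ u, tensorAct g (F u) a b c d ∂haarGate =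
      tensorAct g (fun a b c d => ∫ u, F u a b c d ∂haarGate) a b c d := by
  simp only [tensorAct]
  iterate 3
    rw [integral_finsetSum _ (fun _ _ => integrable_haarGate (by fun_prop))]
    refine Finset.sum_congr rfl fun _ _ => ?_
    rw [integral_const_mul]
    congr 1
  rw [integral_finsetSum _ (fun _ _ => integrable_haarGate (by fun_prop))]
  exact Finset.sum_congr rfl fun _ _ => integral_const_mul _ _

/-- The Haar average of a tensor. -/
def twirl (G : Config 2 → Config 2 → Config 2 → Config 2 → ℂ) (a b c d : Config 2) : ℂ :=
  ∫ u : TwoQubitGate, tensorAct (u : Matrix (Config 2) (Config 2) ℂ) G a b c d ∂haarGate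

/-- Left invariance of the Haar measure absorbs `g` into the integration variable. -/
lemma twirlInvariant_twirl (G : Config 2 → Config 2 → Config 2 → Config 2 → ℂ) :
    TwirlInvariant (twirl G) := by
  intro g hg
  funext a b c d
  have h := integral_mul_left_eq_self (μ := haarGate) (fun u : TwoQubitGate =>
    tensorAct (u : Matrix (Config 2) (Config 2) ℂ) G a b c d) ⟨g, hg⟩
  refine Eq.trans ?_ h
  simp only [Submonoid.coe_mul, tensorAct_mul]
  exact (integral_tensorAct g (F := fun u => tensorAct (u : Matrix (Config 2) (Config 2) ℂ) G)
    (continuous_tensorAct G) a b c d).symm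

lemma integral_sum_sum {f : TwoQubitGate → Config 2 → Config 2 → ℂ}
    (hf : ∀ a b, Continuous fun u => f u a b) :
    ∫ u, ∑ a, ∑ b, f u a b ∂haarGate = ∑ a, ∑ b, ∫ u, f u a b ∂haarGate := by
  rw [integral_finsetSum _ (fun _ _ => integrable_haarGate (by fun_prop))]
  exact Finset.sum_congr rfl fun _ _ =>
    integral_finsetSum _ (fun _ _ => integrable_haarGate (by fun_prop))

lemma twirl_contract_parallel (G : Config 2 → Config 2 → Config 2 → Config 2 → ℂ) :
    ∑ a, ∑ b, twirl G a b a b = ∑ a, ∑ b, G a b a b := by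
  unfold twirl
  rw [← integral_sum_sum (fun _ _ => continuous_tensorAct G _ _ _ _)]
  simp [tensorAct_contract_parallel (Subtype.prop _)]

lemma twirl_contract_crossed (G : Config 2 → Config 2 → Config 2 → Config 2 → ℂ) :
    ∑ a, ∑ b, twirl G a b b a = ∑ a, ∑ b, G a b b a := by
  unfold twirl
  rw [← integral_sum_sum (fun _ _ => continuous_tensorAct G _ _ _ _)]
  simp [tensorAct_contract_crossed (Subtype.prop _)]

/-- Exchanging one of the two qubits contracts a twirled tensor to `2/5` of the sum of the full
contractions. -/
lemma twirl_contract_partial (G : Config 2 → Config 2 → Config 2 → Config 2 → ℂ)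
    (i : Fin 2) :
    ∑ a, ∑ b, twirl G a b (fun j => if j = i then b j else a j)
        (fun j => if j = i then a j else b j) =
      2 / 5 * (∑ a, ∑ b, G a b b a + ∑ a, ∑ b, G a b a b) := by
  obtain ⟨A, B, h⟩ := (twirlInvariant_twirl G).exists_eq (x := 0) (y := 1)
    (fun h => zero_ne_one (congrFun h 0))
  rw [← twirl_contract_parallel, ← twirl_contract_crossed]
  simp only [h, Finset.sum_add_distrib]
  have hsum : ∀ (P : Config 2 → Config 2 → Prop) [∀ a b, Decidable (P a b)] (z : ℂ),
      ∑ a, ∑ b, (if P a b then z else 0) =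
        ((Finset.univ.filter fun p : Config 2 × Config 2 => P p.1 p.2).card : ℂ) * z := by
    intro P _ z
    rw [← Fintype.sum_prod_type' (f := fun a b => if P a b then z else 0), Finset.sum_ite]
    simp
  simp only [hsum]
  -- For the two invariants A and B, the parallel contraction is 16A + 4B, the crossed one 4A + 16B,
  -- and exchanging one qubit gives 8A + 8B, which is 2/5 of their sum.
  have c1 : (Finset.univ.filter fun p : Config 2 × Config 2 => p.1 = p.2 ∧ p.2 = p.1).card = 4 := by
    decide
  have c2 : (Finset.univ.filter fun p : Config 2 × Config 2 => True ∧ True).card = 16 := by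
    decide
  have c3 : (Finset.univ.filter fun p : Config 2 × Config 2 =>
      (p.1 = fun j => if j = i then p.2 j else p.1 j) ∧
        p.2 = fun j => if j = i then p.1 j else p.2 j).card = 8 := by
    revert i; decide
  have c4 : (Finset.univ.filter fun p : Config 2 × Config 2 =>
      (p.1 = fun j => if j = i then p.1 j else p.2 j) ∧
        p.2 = fun j => if j = i then p.2 j else p.1 j).card = 8 := by
    revert i; decide
  rw [c1, c2, c3, c4]
  push_cast
  ring

/-- The effect of averaging over a gate on the pair `e` on functions of subsets. -/
def pairStep {N : ℕ} (e : Fin 2 ↪ Fin N) (f : Finset (Fin N) → ℝ) (S : Finset (Fin N)) : ℝ :=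
  if (e 0 ∈ S ↔ e 1 ∈ S) then f S
  else 2 / 5 * (f (S ∪ {e 0, e 1}) + f (S \ {e 0, e 1}))

variable {N : ℕ} (e : Fin 2 ↪ Fin N)

lemma continuous_purity_embedGate (S : Finset (Fin N)) (φ : Config N → ℂ) :
    Continuous fun u : TwoQubitGate => purityC S (embedGate e u.1 *ᵥ φ) := by
  simp only [purityC_eq_tensor e, purityTensor_embedGate]
  exact continuous_finsetSum _ fun a _ => continuous_finsetSum _ fun b _ =>
    continuous_tensorAct _ _ _ _ _

/-- If the pair is not split, the purity is a full crossed or parallel contraction, and unitarity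
preserves it for every single gate, without averaging. -/
lemma purityC_embedGate_of_iff {S : Finset (Fin N)} (h : e 0 ∈ S ↔ e 1 ∈ S) (u : TwoQubitGate)
    (φ : Config N → ℂ) : purityC S (embedGate e u.1 *ᵥ φ) = purityC S φ := by
  have h' : ∀ j, e j ∈ S ↔ e 0 ∈ S := by
    intro j
    fin_cases j
    · rfl
    · exact h.symm
  simp only [purityC_eq_tensor e, purityTensor_embedGate, h']
  by_cases h0 : e 0 ∈ S
  · simpa [h0] using tensorAct_contract_crossed u.2 _
  · simpa [h0] using tensorAct_contract_parallel u.2 _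

lemma integral_purity_embedGate (S : Finset (Fin N)) (φ : Config N → ℂ) :
    ∫ u : TwoQubitGate, purity S (embedGate e u.1 *ᵥ φ) ∂haarGate =
      pairStep e (fun S => purity S φ) S := by
  by_cases h : e 0 ∈ S ↔ e 1 ∈ S
  · simp [pairStep, h, purity, purityC_embedGate_of_iff e h]
  have hC : ∫ u : TwoQubitGate, purityC S (embedGate e u.1 *ᵥ φ) ∂haarGate =
      2 / 5 * (purityC (S ∪ {e 0, e 1}) φ + purityC (S \ {e 0, e 1}) φ) := by
    have hp : ∀ i, i ∉ Set.range e → i ≠ e 0 ∧ i ≠ e 1 :=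
      fun i hi => ⟨fun h => hi ⟨0, h.symm⟩, fun h => hi ⟨1, h.symm⟩⟩
    have hu : purityTensor e (S ∪ {e 0, e 1}) φ = purityTensor e S φ :=
      purityTensor_congr e (fun i hi => by simp [hp i hi]) φ
    have hd : purityTensor e (S \ {e 0, e 1}) φ = purityTensor e S φ :=
      purityTensor_congr e (fun i hi => by simp [hp i hi]) φ
    have hu' : ∀ j, e j ∈ S ∪ {e 0, e 1} := by
      intro j; fin_cases j <;> simp
    have hd' : ∀ j, e j ∉ S \ {e 0, e 1} := by
      intro j; fin_cases j <;> simp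
    obtain ⟨i, hi⟩ : ∃ i, ∀ j, e j ∈ S ↔ j = i := by
      by_cases h0 : e 0 ∈ S
      · refine ⟨0, fun j => ?_⟩
        fin_cases j
        · simpa using h0
        · simpa using fun h1 => h ⟨fun _ => h1, fun _ => h0⟩
      · refine ⟨1, fun j => ?_⟩
        fin_cases j
        · simpa using h0
        · by_contra h1
          exact h ⟨fun h' => absurd h' h0, fun h' => absurd (by simpa using h') h1⟩
    simp only [purityC_eq_tensor e, purityTensor_embedGate, hu, hd, hu', hd', hi, if_true, if_false]
    rw [integral_sum_sum (fun _ _ => continuous_tensorAct _ _ _ _ _)]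
    exact twirl_contract_partial _ i
  have hre := integral_re (integrable_haarGate (continuous_purity_embedGate e S φ))
  simp only [RCLike.re_eq_complex_re] at hre
  simp only [pairStep, h, if_false, purity]
  rw [hre, hC]
  simp [Complex.mul_re]

end

/-! ### Decay of the mean purity to its stationary value. -/

noncomputable section

/-! ### The combinatorics of one layer -/

/-- The stationary part of the averaged purity. -/
def stationaryPurity {N : ℕ} (S : Finset (Fin N)) : ℝ :=
  (1 / 2) ^ S.card + (1 / 2) ^ Sᶜ.card

/-- `S` does not separate the two qubits of `e`. -/
def Unsplit {N : ℕ} (e : Fin 2 ↪ Fin N) (S : Finset (Fin N)) : Prop := e 0 ∈ S ↔ e 1 ∈ S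

lemma pairStep_of_unsplit {N : ℕ} {e : Fin 2 ↪ Fin N} {S : Finset (Fin N)} (h : Unsplit e S)
    (f : Finset (Fin N) → ℝ) : pairStep e f S = f S := if_pos h

lemma pairStep_of_not_unsplit {N : ℕ} {e : Fin 2 ↪ Fin N} {S : Finset (Fin N)}
    (h : ¬ Unsplit e S) (f : Finset (Fin N) → ℝ) :
    pairStep e f S = 2 / 5 * (f (S ∪ {e 0, e 1}) + f (S \ {e 0, e 1})) := if_neg h

/-- Moving one qubit across the cut halves one of the two powers and doubles the other, and 2/5 ·
(1/2 + 2) = 1. -/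
lemma stationaryPurity_union_sdiff {N : ℕ} {S : Finset (Fin N)} {a b : Fin N} (ha : a ∈ S)
    (hb : b ∉ S) : 2 / 5 * (stationaryPurity (S ∪ {a, b}) + stationaryPurity (S \ {a, b})) =
      stationaryPurity S := by
  have hu : S ∪ {a, b} = insert b S := by
    ext i; simp only [Finset.mem_union, Finset.mem_insert, Finset.mem_singleton]
    constructor
    · rintro (h | rfl | rfl) <;> tauto
    · tauto
  have hd : S \ {a, b} = S.erase a := by
    ext i; simp only [Finset.mem_sdiff, Finset.mem_insert, Finset.mem_singleton, Finset.mem_erase]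
    constructor
    · tauto
    · rintro ⟨h1, h2⟩
      refine ⟨h2, ?_⟩
      rintro (rfl | rfl) <;> tauto
  have hbc : b ∈ Sᶜ := by simpa using hb
  have hac : a ∉ Sᶜ := by simpa using ha
  rw [hu, hd]
  simp only [stationaryPurity, Finset.compl_insert, Finset.compl_erase]
  rw [Finset.card_insert_of_notMem hb, Finset.card_insert_of_notMem hac]
  obtain ⟨x, hx⟩ : ∃ x, S.card = x + 1 := ⟨S.card - 1, by
    have := Finset.card_pos.mpr ⟨a, ha⟩; omega⟩
  obtain ⟨y, hy⟩ : ∃ y, Sᶜ.card = y + 1 := ⟨Sᶜ.card - 1, by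
    have := Finset.card_pos.mpr ⟨b, hbc⟩; omega⟩
  rw [Finset.card_erase_of_mem ha, Finset.card_erase_of_mem hbc, hx, hy]
  simp only [Nat.add_sub_cancel, pow_succ]
  ring

lemma pairStep_stationaryPurity {N : ℕ} (e : Fin 2 ↪ Fin N) (S : Finset (Fin N)) :
    pairStep e stationaryPurity S = stationaryPurity S := by
  by_cases h : Unsplit e S
  · exact pairStep_of_unsplit h _
  rw [pairStep_of_not_unsplit h]
  by_cases h0 : e 0 ∈ S
  · exact stationaryPurity_union_sdiff h0 fun h1 => h ⟨fun _ => h1, fun _ => h0⟩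
  · rw [Finset.pair_comm]
    refine stationaryPurity_union_sdiff ?_ h0
    by_contra h1
    exact h ⟨fun h' => absurd h' h0, fun h' => absurd h' h1⟩

/-- The effect of averaging over the gates on the pairs `e j`, `j ∈ l`. -/
def listStep {N : ℕ} {κ : Type*} (e : κ → Fin 2 ↪ Fin N) (l : List κ)
    (f : Finset (Fin N) → ℝ) : Finset (Fin N) → ℝ :=
  l.foldr (fun j f => pairStep (e j) f) f

/-- `S` separates none of the pairs `e j`, `j ∈ l`. -/
def UnsplitAll {N : ℕ} {κ : Type*} (e : κ → Fin 2 ↪ Fin N) (l : List κ) (S : Finset (Fin N)) :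
    Prop := ∀ j ∈ l, Unsplit (e j) S

open Classical in
-- The stationary part is reproduced exactly, while the excess `r` is passed on with weight 2/5 +
-- 2/5 at a split pair. The bound on `f` is required only on sets unsplit by the whole layer,
-- because only those remain when all pairs have been treated. The predicate `C` records the pairs
-- already treated during the induction.
lemma listStep_le {N : ℕ} {κ : Type*} (e : κ → Fin 2 ↪ Fin N)
    (hdisj : ∀ j j', j ≠ j' → ∀ b b', e j b ≠ e j' b') {r : ℝ} (hr : 0 ≤ r) (l : List κ) :
    l.Nodup → ∀ (C : Finset (Fin N) → Prop) (f : Finset (Fin N) → ℝ),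
      (∀ j ∈ l, ∀ S, C S → C (S ∪ {e j 0, e j 1}) ∧ C (S \ {e j 0, e j 1})) →
      (∀ S, C S → (∀ j ∈ l, Unsplit (e j) S) → f S ≤ stationaryPurity S + r) →
      ∀ S, C S → listStep e l f S ≤
        stationaryPurity S + r * if UnsplitAll e l S then 1 else 4 / 5 := by
  induction l with
  | nil =>
    intro _ C f _ hf S hS
    simpa [listStep, UnsplitAll] using hf S hS (by simp)
  | cons j l ih =>
    intro hl C f hC hf S hS
    obtain ⟨hj, hl⟩ := List.nodup_cons.mp hl
    have hinv : ∀ j' ∈ l, ∀ S, (Unsplit (e j) (S ∪ {e j' 0, e j' 1}) ↔ Unsplit (e j) S) ∧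
        (Unsplit (e j) (S \ {e j' 0, e j' 1}) ↔ Unsplit (e j) S) := by
      intro j' hj' S
      have hne : j ≠ j' := fun h => hj (h ▸ hj')
      simp [Unsplit, hdisj j j' hne]
    -- Treating the pair `e j` makes the set unsplit there, and the remaining pairs, being disjoint
    -- from it, keep it so.
    have key := ih hl (fun S => C S ∧ Unsplit (e j) S) f
      (fun j' hj' S hS => ⟨⟨(hC j' (List.mem_cons_of_mem _ hj') S hS.1).1,
          ((hinv j' hj' S).1).mpr hS.2⟩, ⟨(hC j' (List.mem_cons_of_mem _ hj') S hS.1).2,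
          ((hinv j' hj' S).2).mpr hS.2⟩⟩)
      (fun S hS h => hf S hS.1 (by
        intro j' hj'
        rcases List.mem_cons.mp hj' with rfl | h'
        · exact hS.2
        · exact h j' h'))
    show pairStep (e j) (listStep e l f) S ≤ _
    by_cases h : Unsplit (e j) S
    · rw [pairStep_of_unsplit h]
      have hiff : UnsplitAll e (j :: l) S ↔ UnsplitAll e l S := by simp [UnsplitAll, h]
      simp only [hiff]
      exact key S ⟨hS, h⟩
    · have hCj := hC j List.mem_cons_self S hS
      -- One factor 4/5 per layer is enough; further gains from the remaining pairs are dropped.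
      have hw : ∀ (p : Prop) [Decidable p], r * (if p then 1 else 4 / 5) ≤ r := by
        intro p _
        split_ifs <;> linarith
      have h1 := (key (S ∪ {e j 0, e j 1}) ⟨hCj.1, by simp [Unsplit]⟩).trans
        (add_le_add_right (hw _) _)
      have h2 := (key (S \ {e j 0, e j 1}) ⟨hCj.2, by simp [Unsplit]⟩).trans
        (add_le_add_right (hw _) _)
      have h3 := pairStep_stationaryPurity (e j) S
      rw [pairStep_of_not_unsplit h] at h3 ⊢
      have : ¬ UnsplitAll e (j :: l) S := fun h' => h (h' j List.mem_cons_self)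
      rw [if_neg this]
      linarith

/-! ### The pairs of the brickwork -/

lemma brickPair_val {m : ℕ} (s : ℕ) (j : Fin m) (b : Fin 2) :
    (brickPair s j b : ℕ) = (2 * (j : ℕ) + s % 2 + b) % (2 * m) := rfl

lemma brickPair_disjoint {m : ℕ} (s : ℕ) (j j' : Fin m) (h : j ≠ j') (b b' : Fin 2) :
    brickPair s j b ≠ brickPair s j' b' := by
  intro heq
  have h' := congrArg Fin.val heq
  have hj := j.isLt
  have hj' := j'.isLt
  have hs : s % 2 < 2 := Nat.mod_lt _ (by norm_num)
  have hb := b.isLt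
  have hb' := b'.isLt
  have hne : (j : ℕ) ≠ j' := fun h'' => h (Fin.ext h'')
  rw [brickPair_val, brickPair_val] at h'
  -- The labels before reduction are below 2m + 2, so they wrap around the ring at most once.
  have key : ∀ k : ℕ, k < 2 * m + 2 → k % (2 * m) = if k < 2 * m then k else k - 2 * m := by
    intro k hk
    split_ifs with hlt
    · exact Nat.mod_eq_of_lt hlt
    · rw [Nat.mod_eq_sub_mod (by omega), Nat.mod_eq_of_lt (by omega)]
  rw [key _ (by omega), key _ (by omega)] at h'
  split_ifs at h' <;> omega

/-- A set that splits no pair of two consecutive layers is trivial. -/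
lemma eq_empty_or_univ_of_unsplit {m : ℕ} (s : ℕ) (S : Finset (Fin (2 * m)))
    (h0 : ∀ j : Fin m, Unsplit (brickPair s j) S)
    (h1 : ∀ j : Fin m, Unsplit (brickPair (s + 1) j) S) : S = ∅ ∨ S = Finset.univ := by
  -- The two layers together link all neighbours k, k + 1; the link across the boundary is not
  -- needed.
  have hstep : ∀ k (hk : k + 1 < 2 * m),
      (⟨k, by omega⟩ : Fin (2 * m)) ∈ S ↔ (⟨k + 1, hk⟩ : Fin (2 * m)) ∈ S := by
    intro k hk
    have hpair : ∀ s', s' % 2 = k % 2 → Unsplit (brickPair s' ⟨k / 2, by omega⟩) S →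
        ((⟨k, by omega⟩ : Fin (2 * m)) ∈ S ↔ (⟨k + 1, hk⟩ : Fin (2 * m)) ∈ S) := by
      intro s' hs' h
      have e0 : brickPair s' (⟨k / 2, by omega⟩ : Fin m) 0 = ⟨k, by omega⟩ := by
        apply Fin.ext
        rw [brickPair_val, hs', Fin.val_zero]; dsimp only
        rw [Nat.mod_eq_of_lt (by omega)]; omega
      have e1 : brickPair s' (⟨k / 2, by omega⟩ : Fin m) 1 = ⟨k + 1, hk⟩ := by
        apply Fin.ext
        rw [brickPair_val, hs', Fin.val_one]; dsimp only
        rw [Nat.mod_eq_of_lt (by omega)]; omega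
      rw [Unsplit, e0, e1] at h
      exact h
    rcases (by omega : s % 2 = k % 2 ∨ (s + 1) % 2 = k % 2) with h | h
    · exact hpair s h (h0 _)
    · exact hpair (s + 1) h (h1 _)
  rcases Nat.eq_zero_or_pos m with rfl | hm
  · left; ext i; exact i.elim0
  have hall : ∀ k (hk : k < 2 * m), (⟨k, hk⟩ : Fin (2 * m)) ∈ S ↔
      (⟨0, by omega⟩ : Fin (2 * m)) ∈ S := by
    intro k
    induction k with
    | zero => intro _; rfl
    | succ k ih => intro hk; rw [← hstep k hk]; exact ih (by omega)
  by_cases h : (⟨0, by omega⟩ : Fin (2 * m)) ∈ S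
  · right; ext i; simpa using (hall i i.2).mpr h
  · left; ext i; simpa using fun h' => h ((hall i i.2).mp h')

/-! ### Averages over layers and circuits -/

/-- Resampling one coordinate independently does not change a product law. This permits integrating
out a single gate while keeping the same space of gates. -/
lemma measurePreserving_update {ι : Type*} [Fintype ι] [DecidableEq ι] {α : ι → Type*}
    [∀ i, MeasurableSpace (α i)] (μ : ∀ i, Measure (α i)) [∀ i, IsProbabilityMeasure (μ i)]
    (j : ι) : MeasurePreserving (fun p : (∀ i, α i) × α j => Function.update p.1 j p.2)
      ((Measure.pi μ).prod (μ j)) (Measure.pi μ) := by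
  have hmeas : Measurable fun p : (∀ i, α i) × α j => Function.update p.1 j p.2 := by
    rw [measurable_pi_iff]
    intro i
    by_cases h : i = j
    · subst h; simpa using measurable_snd
    · simpa [h, Function.comp_def] using (measurable_pi_apply i).comp measurable_fst
  refine ⟨hmeas, (Measure.pi_eq fun s hs => ?_).symm⟩
  · rw [Measure.map_apply hmeas (MeasurableSet.univ_pi hs)]
    have hpre : (fun p : (∀ i, α i) × α j => Function.update p.1 j p.2) ⁻¹' Set.univ.pi s =
        Set.univ.pi (Function.update s j Set.univ) ×ˢ s j := by
      ext p
      simp only [Set.mem_preimage, Set.mem_univ_pi, Set.mem_prod]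
      constructor
      · intro h
        refine ⟨fun i => ?_, by simpa using h j⟩
        by_cases hi : i = j
        · subst hi; simp
        · simpa [hi] using h i
      · rintro ⟨h1, h2⟩ i
        by_cases hi : i = j
        · subst hi; simpa using h2
        · simpa [hi] using h1 i
    rw [hpre, Measure.prod_prod, Measure.pi_pi, ← Finset.mul_prod_erase _ _ (Finset.mem_univ j),
      ← Finset.mul_prod_erase (f := fun i => μ i (s i)) _ (Finset.mem_univ j)]
    have : ∏ i ∈ Finset.univ.erase j, μ i (Function.update s j Set.univ i) =
        ∏ i ∈ Finset.univ.erase j, μ i (s i) :=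
      Finset.prod_congr rfl fun i hi => by rw [Function.update_of_ne (Finset.ne_of_mem_erase hi)]
    rw [this]
    simp [mul_comm]

lemma integral_update {ι : Type*} [Fintype ι] [DecidableEq ι] {f : (ι → TwoQubitGate) → ℝ}
    (hf : Continuous f) (j : ι) :
    ∫ u, f u ∂Measure.pi (fun _ : ι => haarGate) =
      ∫ u, ∫ g, f (Function.update u j g) ∂haarGate ∂Measure.pi (fun _ : ι => haarGate) := by
  have hmp := measurePreserving_update (fun _ : ι => haarGate) j
  rw [← integral_prod (f := fun p : (ι → TwoQubitGate) × TwoQubitGate => f (Function.update p.1 j p.2))]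
  · conv_lhs => rw [← hmp.map_eq]
    exact integral_map hmp.measurable.aemeasurable hf.aestronglyMeasurable
  · refine Continuous.integrable_of_hasCompactSupport ?_ (HasCompactSupport.of_compactSpace _)
    exact hf.comp (continuous_fst.update j continuous_snd)

lemma continuous_purity {N : ℕ} (S : Finset (Fin N)) :
    Continuous fun φ : Config N → ℂ => purity S φ := by
  unfold purity purityC
  fun_prop

lemma continuous_embedGate {N k : ℕ} (e : Fin k ↪ Fin N) :
    Continuous fun u : Matrix (Config k) (Config k) ℂ => embedGate e u := by
  classical
  refine continuous_matrix fun z w => ?_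
  unfold embedGate
  split_ifs
  · exact continuous_id.matrix_elem _ _
  · exact continuous_const

lemma continuous_gates_prod {N : ℕ} {κ : Type*} (e : κ → Fin 2 ↪ Fin N) (l : List κ) :
    Continuous fun u : κ → TwoQubitGate => (l.map fun j => embedGate (e j) (u j).1).prod :=
  continuous_list_prod l fun j _ =>
    (continuous_embedGate (e j)).comp (continuous_subtype_val.comp (continuous_apply j))

lemma integral_pairStep {Ω : Type*} [MeasurableSpace Ω] {μ : Measure Ω} {N : ℕ}
    (e : Fin 2 ↪ Fin N) {f : Ω → Finset (Fin N) → ℝ} (hf : ∀ S, Integrable (fun ω => f ω S) μ)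
    (S : Finset (Fin N)) :
    Integrable (fun ω => pairStep e (f ω) S) μ ∧
      ∫ ω, pairStep e (f ω) S ∂μ = pairStep e (fun S => ∫ ω, f ω S ∂μ) S := by
  by_cases h : Unsplit e S
  · simp only [pairStep_of_unsplit h]
    exact ⟨hf S, trivial⟩
  · simp only [pairStep_of_not_unsplit h]
    refine ⟨((hf _).add (hf _)).const_mul _, ?_⟩
    rw [integral_const_mul, integral_add (hf _) (hf _)]

lemma integral_listStep {Ω : Type*} [MeasurableSpace Ω] {μ : Measure Ω} {N : ℕ} {κ : Type*}
    (e : κ → Fin 2 ↪ Fin N) {f : Ω → Finset (Fin N) → ℝ}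
    (hf : ∀ S, Integrable (fun ω => f ω S) μ) (l : List κ) (S : Finset (Fin N)) :
    Integrable (fun ω => listStep e l (f ω) S) μ ∧
      ∫ ω, listStep e l (f ω) S ∂μ = listStep e l (fun S => ∫ ω, f ω S ∂μ) S := by
  induction l generalizing S with
  | nil => exact ⟨hf S, rfl⟩
  | cons j l ih =>
    have h := integral_pairStep (e j) (f := fun ω => listStep e l (f ω)) (fun S => (ih S).1) S
    refine ⟨h.1, h.2.trans ?_⟩
    simp only [fun S => (ih S).2]
    rfl

lemma integral_gates_prod {N : ℕ} {κ : Type*} [Fintype κ] [DecidableEq κ]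
    (e : κ → Fin 2 ↪ Fin N) (φ : Config N → ℂ) (l : List κ) (hl : l.Nodup)
    (S : Finset (Fin N)) :
    ∫ u : κ → TwoQubitGate, purity S ((l.map fun j => embedGate (e j) (u j).1).prod *ᵥ φ)
      ∂Measure.pi (fun _ => haarGate) = listStep e l (fun S => purity S φ) S := by
  have hcont : ∀ (l : List κ) S, Continuous fun u : κ → TwoQubitGate =>
      purity S ((l.map fun j => embedGate (e j) (u j).1).prod *ᵥ φ) := fun l S =>
    (continuous_purity S).comp ((continuous_gates_prod e l).matrix_mulVec continuous_const)
  induction l generalizing S with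
  | nil => simp [listStep]
  | cons j l ih =>
    obtain ⟨hj, hl⟩ := List.nodup_cons.mp hl
    -- The head of the list acts last, so it is averaged first with the other gates fixed; as the
    -- list has no repetitions, resampling it leaves the tail unchanged.
    rw [integral_update (hcont _ S) j]
    have : ∀ (u : κ → TwoQubitGate) (g : TwoQubitGate),
        ((j :: l).map fun i => embedGate (e i) (Function.update u j g i).1).prod *ᵥ φ =
          embedGate (e j) g.1 *ᵥ ((l.map fun i => embedGate (e i) (u i).1).prod *ᵥ φ) := by
      intro u g
      rw [List.map_cons, List.prod_cons, Function.update_self, ← Matrix.mulVec_mulVec]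
      congr 3
      refine List.map_congr_left fun i hi => ?_
      rw [Function.update_of_ne]
      rintro rfl
      exact hj hi
    simp only [this, integral_purity_embedGate]
    rw [(integral_pairStep (e j) (fun S => (hcont l S).integrable_of_hasCompactSupport
      (HasCompactSupport.of_compactSpace _)) S).2]
    simp only [fun S => ih hl S]
    rfl

instance (m t : ℕ) : IsProbabilityMeasure (brickMeasure m t) := by
  unfold brickMeasure; infer_instance

lemma brickCircuit_snoc {m t : ℕ} (u : Fin t → Fin m → TwoQubitGate) (v : Fin m → TwoQubitGate) :
    brickCircuit (Fin.snoc (α := fun _ => Fin m → TwoQubitGate) u v) = brickLayer t v * brickCircuit u := by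
  simp [brickCircuit, List.finRange_succ_last, Function.comp_def]

lemma continuous_brickLayer {m : ℕ} (s : ℕ) :
    Continuous fun u : Fin m → TwoQubitGate => brickLayer s u :=
  continuous_gates_prod (brickPair s) _

lemma continuous_brickCircuit {m t : ℕ} :
    Continuous fun u : Fin t → Fin m → TwoQubitGate => brickCircuit u := by
  unfold brickCircuit
  simp only [← List.map_reverse]
  exact continuous_list_prod _ fun s _ => (continuous_brickLayer _).comp (continuous_apply s)

/-- The averaged purity of the output of a brickwork circuit. -/
def meanPurity {m : ℕ} (ψ : Config (2 * m) → ℂ) (t : ℕ) (S : Finset (Fin (2 * m))) : ℝ :=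
  ∫ u, purity S (brickCircuit u *ᵥ ψ) ∂brickMeasure m t

lemma continuous_purity_brickCircuit {m t : ℕ} (ψ : Config (2 * m) → ℂ)
    (S : Finset (Fin (2 * m))) : Continuous fun u : Fin t → Fin m → TwoQubitGate =>
      purity S (brickCircuit u *ᵥ ψ) :=
  (continuous_purity S).comp (continuous_brickCircuit.matrix_mulVec continuous_const)

lemma integrable_purity_brickCircuit {m t : ℕ} (ψ : Config (2 * m) → ℂ)
    (S : Finset (Fin (2 * m))) : Integrable (fun u : Fin t → Fin m → TwoQubitGate =>
      purity S (brickCircuit u *ᵥ ψ)) (brickMeasure m t) :=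
  (continuous_purity_brickCircuit ψ S).integrable_of_hasCompactSupport
    (HasCompactSupport.of_compactSpace _)

lemma meanPurity_succ {m : ℕ} (ψ : Config (2 * m) → ℂ) (t : ℕ) (S : Finset (Fin (2 * m))) :
    meanPurity ψ (t + 1) S =
      listStep (brickPair t) (List.finRange m) (meanPurity ψ t) S := by
  have hmp := (measurePreserving_piFinSuccAbove
    (fun _ : Fin (t + 1) => Measure.pi fun _ : Fin m => haarGate) (Fin.last t)).symm
  have h1 : meanPurity ψ (t + 1) S = ∫ p : (Fin m → TwoQubitGate) × (Fin t → Fin m → TwoQubitGate),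
      purity S (brickLayer t p.1 *ᵥ (brickCircuit p.2 *ᵥ ψ))
        ∂(Measure.pi fun _ => haarGate).prod (brickMeasure m t) := by
    rw [meanPurity, brickMeasure, ← hmp.integral_comp']
    refine integral_congr_ae (Filter.Eventually.of_forall fun p => ?_)
    have : (MeasurableEquiv.piFinSuccAbove (fun _ : Fin (t + 1) => Fin m → TwoQubitGate)
        (Fin.last t)).symm p = Fin.snoc (α := fun _ => Fin m → TwoQubitGate) p.2 p.1 := by
      simp only [MeasurableEquiv.piFinSuccAbove, Fin.insertNthEquiv_last]
      rfl
    simp only [this, brickCircuit_snoc, Matrix.mulVec_mulVec]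
  rw [h1, integral_prod_symm]
  · have h2 : ∀ u : Fin t → Fin m → TwoQubitGate, ∫ v, purity S (brickLayer t v *ᵥ
        (brickCircuit u *ᵥ ψ)) ∂(Measure.pi fun _ : Fin m => haarGate) =
          listStep (brickPair t) (List.finRange m)
            (fun S => purity S (brickCircuit u *ᵥ ψ)) S := fun u =>
      integral_gates_prod (brickPair t) _ _ (List.nodup_finRange m) S
    simp only [h2]
    exact (integral_listStep (brickPair t)
      (f := fun (u : Fin t → Fin m → TwoQubitGate) S => purity S (brickCircuit u *ᵥ ψ))
      (fun S => integrable_purity_brickCircuit ψ S) (List.finRange m) S).2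
  · refine Continuous.integrable_of_hasCompactSupport ?_ (HasCompactSupport.of_compactSpace _)
    refine (continuous_purity S).comp ?_
    exact ((continuous_brickLayer t).comp continuous_fst).matrix_mulVec
      ((continuous_brickCircuit.comp continuous_snd).matrix_mulVec continuous_const)

/-- The purity of the empty set is the fourth power of the norm, and the empty set splits no pair.
-/
lemma norm_embedGate_mulVec {N : ℕ} (e : Fin 2 ↪ Fin N) (g : TwoQubitGate) (φ : Config N → ℂ) :
    ∑ x, ‖(embedGate e g.1 *ᵥ φ) x‖ ^ 2 = ∑ x, ‖φ x‖ ^ 2 := by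
  have h : purity ∅ (embedGate e g.1 *ᵥ φ) = purity ∅ φ := by
    rw [purity, purityC_embedGate_of_iff e (by simp), purity]
  rw [purity_empty, purity_empty] at h
  exact (pow_left_inj₀ (by positivity) (by positivity) two_ne_zero).mp h

lemma norm_list_prod_mulVec {N : ℕ} (l : List (Matrix (Config N) (Config N) ℂ))
    (h : ∀ A ∈ l, ∀ φ : Config N → ℂ, ∑ x, ‖(A *ᵥ φ) x‖ ^ 2 = ∑ x, ‖φ x‖ ^ 2)
    (φ : Config N → ℂ) : ∑ x, ‖(l.prod *ᵥ φ) x‖ ^ 2 = ∑ x, ‖φ x‖ ^ 2 := by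
  induction l with
  | nil => simp
  | cons A l ih =>
    rw [List.prod_cons, ← Matrix.mulVec_mulVec, h A List.mem_cons_self,
      ih fun B hB => h B (List.mem_cons_of_mem _ hB)]

lemma norm_brickCircuit_mulVec {m t : ℕ} (u : Fin t → Fin m → TwoQubitGate)
    (ψ : Config (2 * m) → ℂ) : ∑ x, ‖(brickCircuit u *ᵥ ψ) x‖ ^ 2 = ∑ x, ‖ψ x‖ ^ 2 := by
  refine norm_list_prod_mulVec _ (fun A hA => ?_) ψ
  simp only [List.mem_reverse, List.mem_map] at hA
  obtain ⟨s, -, rfl⟩ := hA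
  refine norm_list_prod_mulVec _ (fun B hB => ?_)
  obtain ⟨j, -, rfl⟩ := List.mem_map.mp hB
  exact norm_embedGate_mulVec _ _

lemma meanPurity_le_one {m : ℕ} {ψ : Config (2 * m) → ℂ} (hψ : ∑ x, ‖ψ x‖ ^ 2 = 1) (t : ℕ)
    (S : Finset (Fin (2 * m))) : meanPurity ψ t S ≤ 1 := by
  have h : ∀ u : Fin t → Fin m → TwoQubitGate, purity S (brickCircuit u *ᵥ ψ) ≤ 1 := fun u => by
    have := purity_le S (brickCircuit u *ᵥ ψ)
    rwa [norm_brickCircuit_mulVec, hψ, one_pow] at this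
  refine (integral_mono (integrable_purity_brickCircuit ψ S) (integrable_const 1) h).trans ?_
  simp

lemma stationaryPurity_nonneg {N : ℕ} (S : Finset (Fin N)) : 0 ≤ stationaryPurity S := by
  unfold stationaryPurity; positivity

open Classical in
-- The induction carries the better constant for sets split by the last layer. The next layer
-- evaluates the bound only on sets it does not split itself, and a nontrivial one of these is split
-- by the layer before.
lemma meanPurity_succ_le {m : ℕ} {ψ : Config (2 * m) → ℂ} (hψ : ∑ x, ‖ψ x‖ ^ 2 = 1) (t : ℕ)
    (S : Finset (Fin (2 * m))) : meanPurity ψ (t + 1) S ≤ stationaryPurity S +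
      (4 / 5) ^ t * if UnsplitAll (brickPair t) (List.finRange m) S then 1 else 4 / 5 := by
  induction t generalizing S with
  | zero =>
    rw [meanPurity_succ]
    refine listStep_le (brickPair 0) (brickPair_disjoint 0) (r := (4 / 5) ^ 0) (by positivity)
      (List.finRange m)
      (List.nodup_finRange m) (fun _ => True) _ (by simp) (fun S _ _ => ?_) S trivial
    have := meanPurity_le_one hψ 0 S
    have := stationaryPurity_nonneg S
    rw [pow_zero]
    linarith
  | succ t ih =>
    rw [meanPurity_succ]
    refine listStep_le (brickPair (t + 1)) (brickPair_disjoint _) (r := (4 / 5) ^ (t + 1))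
      (by positivity) (List.finRange m)
      (List.nodup_finRange m) (fun _ => True) _ (by simp) (fun S _ hS => ?_) S trivial
    -- Unsplit by two consecutive layers: the set is trivial, and its stationary value already
    -- exceeds any purity.
    by_cases h : UnsplitAll (brickPair t) (List.finRange m) S
    · have h1 : 1 ≤ stationaryPurity S := by
        rcases eq_empty_or_univ_of_unsplit t S (fun j => h j (List.mem_finRange j))
          (fun j => hS j (List.mem_finRange j)) with rfl | rfl <;>
        · simp [stationaryPurity]
      have := meanPurity_le_one hψ (t + 1) S
      have : (0 : ℝ) ≤ (4 / 5) ^ (t + 1) := by positivity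
      linarith
    · have := ih S
      rwa [if_neg h, ← pow_succ] at this

/-- Averaged purity of the output of a brickwork circuit of depth `t + 1`. -/
theorem meanPurity_succ_le_add {m : ℕ} {ψ : Config (2 * m) → ℂ} (hψ : ∑ x, ‖ψ x‖ ^ 2 = 1) (t : ℕ)
    (S : Finset (Fin (2 * m))) :
    meanPurity ψ (t + 1) S ≤ (1 / 2) ^ S.card + (1 / 2) ^ Sᶜ.card + (4 / 5) ^ t := by
  classical
  refine (meanPurity_succ_le hψ t S).trans ?_
  refine add_le_add_right (mul_le_of_le_one_right (by positivity) ?_) _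
  split_ifs <;> norm_num

end

/-! ### From purity to trace distance. -/

noncomputable section

/-! ### The trace norm -/

section TraceNorm

variable {ι : Type*} [Fintype ι]

/-- Bessel's inequality for the family `f`. -/
def IsBessel (f : ι → EuclideanSpace ℂ ι) : Prop :=
  ∀ w, ∑ i, ‖inner ℂ (f i) w‖ ^ 2 ≤ ‖w‖ ^ 2

lemma Orthonormal.isBessel {f : ι → EuclideanSpace ℂ ι} (hf : Orthonormal ℂ f) : IsBessel f :=
  fun w => hf.sum_inner_products_le w

lemma isBessel_of_orthonormal_or_zero {f : ι → EuclideanSpace ℂ ι}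
    (h0 : ∀ i, f i ≠ 0 → ‖f i‖ = 1) (h : ∀ i j, i ≠ j → inner ℂ (f i) (f j) = 0) : IsBessel f := by
  classical
  intro w
  have ho : Orthonormal ℂ (fun i : {i // f i ≠ 0} => f i) :=
    ⟨fun i => h0 i i.2, fun i j hij => h i j fun h' => hij (Subtype.ext h')⟩
  have h1 := ho.sum_inner_products_le w (s := Finset.univ)
  refine le_trans (le_of_eq ?_) h1
  rw [← Finset.sum_subtype (Finset.univ.filter fun i => f i ≠ 0) (p := fun i => f i ≠ 0) (by simp)
    (fun i => ‖inner ℂ (f i) w‖ ^ 2)]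
  refine (Finset.sum_filter_of_ne (p := fun i => f i ≠ 0) ?_).symm
  intro i _ hi h'
  exact hi (by simp [h'])

lemma IsBessel.norm_le_one {f : ι → EuclideanSpace ℂ ι} (hf : IsBessel f) (i : ι) :
    ‖f i‖ ≤ 1 := by
  have h := (Finset.single_le_sum (f := fun j => ‖inner ℂ (f j) (f i)‖ ^ 2)
    (fun _ _ => by positivity) (Finset.mem_univ i)).trans (hf (f i))
  simp only [inner_self_eq_norm_sq_to_K] at h
  simp only [norm_pow, Complex.coe_algebraMap, Complex.norm_real,
    norm_norm] at h
  by_contra h1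
  push Not at h1
  nlinarith [mul_pos (sub_pos.mpr h1) (sub_pos.mpr h1), sq_nonneg ‖f i‖]

variable [DecidableEq ι]

open scoped ComplexOrder in
lemma eigenvalues_conjTranspose_mul_self_nonneg (X : Matrix ι ι ℂ) (i : ι) :
    0 ≤ (Matrix.isHermitian_conjTranspose_mul_self X).eigenvalues i :=
  (Matrix.posSemidef_conjTranspose_mul_self X).eigenvalues_nonneg i

/-- Singular value decomposition, in the form needed for the trace norm. -/
lemma exists_singular_vectors (X : Matrix ι ι ℂ) :
    ∃ (v : OrthonormalBasis ι ℂ (EuclideanSpace ℂ ι)) (h : ι → EuclideanSpace ℂ ι) (s : ι → ℝ),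
      IsBessel h ∧ (∀ i, 0 ≤ s i) ∧ traceNorm X = ∑ i, s i ∧
      (∀ i, Matrix.toEuclideanLin X (v i) = (s i : ℂ) • h i) ∧
      ∀ i, inner ℂ (h i) (Matrix.toEuclideanLin X (v i)) = (s i : ℂ) := by
  have hX := Matrix.isHermitian_conjTranspose_mul_self X
  set lam := hX.eigenvalues with hlam
  set v := hX.eigenvectorBasis with hv
  set T := Matrix.toEuclideanLin X with hT
  have hinner : ∀ i j, inner ℂ (T (v i)) (T (v j)) = if i = j then (lam j : ℂ) else 0 := by
    intro i j
    rw [hT, ← LinearMap.adjoint_inner_right, ← Matrix.toEuclideanLin_conjTranspose_eq_adjoint]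
    have : Matrix.toEuclideanLin Xᴴ (Matrix.toEuclideanLin X (v j)) = (lam j : ℂ) • v j := by
      apply (WithLp.ofLp_injective 2)
      simp only [Matrix.ofLp_toLpLin, Matrix.toLin'_apply, Matrix.mulVec_mulVec]
      exact hX.mulVec_eigenvectorBasis j
    rw [this, inner_smul_right, orthonormal_iff_ite.mp v.orthonormal]
    split_ifs <;> simp
  have hnonneg : ∀ i, 0 ≤ lam i := eigenvalues_conjTranspose_mul_self_nonneg X
  have hnorm : ∀ i, ‖T (v i)‖ = Real.sqrt (lam i) := by
    intro i
    rw [@norm_eq_sqrt_re_inner ℂ, hinner]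
    simp
  have hsm : ∀ i, T (v i) = (Real.sqrt (lam i) : ℂ) • ((Real.sqrt (lam i) : ℂ)⁻¹ • T (v i)) := by
    intro i
    by_cases h : Real.sqrt (lam i) = 0
    · have : T (v i) = 0 := by rw [← norm_eq_zero, hnorm, h]
      simp [this]
    · rw [smul_smul, mul_inv_cancel₀ (by exact_mod_cast h), one_smul]
  -- For a zero singular value the convention 0⁻¹ = 0 gives the zero vector. The left family is then
  -- not orthonormal, but it still satisfies Bessel's inequality.
  refine ⟨v, fun i => (Real.sqrt (lam i) : ℂ)⁻¹ • T (v i), fun i => Real.sqrt (lam i), ?_,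
    fun i => Real.sqrt_nonneg _, rfl, hsm, fun i => ?_⟩
  · refine isBessel_of_orthonormal_or_zero (fun i hi => ?_) (fun i j hij => ?_)
    · have : Real.sqrt (lam i) ≠ 0 := by
        intro h
        simp [h] at hi
      rw [norm_smul, hnorm, norm_inv, Complex.norm_real, Real.norm_of_nonneg (Real.sqrt_nonneg _),
        inv_mul_cancel₀ this]
    · rw [inner_smul_left, inner_smul_right, hinner, if_neg hij]
      simp
  · rw [inner_smul_left, hinner, if_pos rfl]
    by_cases h : Real.sqrt (lam i) = 0
    · have : lam i = 0 := (Real.sqrt_eq_zero (hnonneg i)).mp h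
      simp [this]
    · have h' : (Real.sqrt (lam i) : ℂ) ≠ 0 := by exact_mod_cast h
      have h2 : (lam i : ℂ) = (Real.sqrt (lam i) : ℂ) * (Real.sqrt (lam i) : ℂ) := by
        exact_mod_cast (Real.mul_self_sqrt (hnonneg i)).symm
      rw [map_inv₀, Complex.conj_ofReal]
      rw [h2, ← mul_assoc, inv_mul_cancel₀ h', one_mul]

/-- The variational half of the trace norm: expand in singular vectors, apply 2ab ≤ a² + b², and sum
with Bessel. The singular vectors attain equality, whence the triangle inequality. -/
lemma re_sum_inner_le_traceNorm (X : Matrix ι ι ℂ) {f g : ι → EuclideanSpace ℂ ι}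
    (hf : IsBessel f) (hg : IsBessel g) :
    (∑ i, inner ℂ (f i) (Matrix.toEuclideanLin X (g i))).re ≤ traceNorm X := by
  obtain ⟨v, h, s, hh, hs, hX, hsv, -⟩ := exists_singular_vectors X
  have hexp : ∀ i, inner ℂ (f i) (Matrix.toEuclideanLin X (g i)) =
      ∑ k, (s k : ℂ) * (inner ℂ (v k) (g i) * inner ℂ (f i) (h k)) := by
    intro i
    conv_lhs => rw [← v.sum_repr' (g i)]
    rw [map_sum, inner_sum]
    refine Finset.sum_congr rfl fun k _ => ?_
    rw [map_smul, hsv, inner_smul_right, inner_smul_right]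
    ring
  have hterm : ∀ i k, ((s k : ℂ) * (inner ℂ (v k) (g i) * inner ℂ (f i) (h k))).re ≤
      s k * ((‖inner ℂ (g i) (v k)‖ ^ 2 + ‖inner ℂ (f i) (h k)‖ ^ 2) / 2) := by
    intro i k
    refine (Complex.re_le_norm _).trans ?_
    rw [norm_mul, norm_mul, Complex.norm_real, Real.norm_of_nonneg (hs k), norm_inner_symm]
    refine mul_le_mul_of_nonneg_left ?_ (hs k)
    nlinarith [sq_nonneg (‖inner ℂ (g i) (v k)‖ - ‖inner ℂ (f i) (h k)‖)]
  simp only [hexp]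
  rw [Finset.sum_comm, hX]
  simp only [Complex.re_sum]
  refine Finset.sum_le_sum fun k _ => (Finset.sum_le_sum fun i _ => hterm i k).trans ?_
  rw [← Finset.mul_sum, ← Finset.sum_div, Finset.sum_add_distrib]
  refine mul_le_of_le_one_right (hs k) ?_
  have h1 := hg (v k)
  have h2 := hf (h k)
  have h3 : ‖v k‖ = 1 := v.orthonormal.1 k
  have h4 := hh.norm_le_one k
  rw [h3] at h1
  have h5 : ‖h k‖ ^ 2 ≤ 1 := pow_le_one₀ (norm_nonneg _) h4
  linarith

lemma traceNorm_add_le (X Y : Matrix ι ι ℂ) :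
    traceNorm (X + Y) ≤ traceNorm X + traceNorm Y := by
  obtain ⟨v, h, s, hh, hs, hX, -, hi⟩ := exists_singular_vectors (X + Y)
  have h1 : traceNorm (X + Y) =
      (∑ i, inner ℂ (h i) (Matrix.toEuclideanLin (X + Y) (v i))).re := by
    simp only [hi, hX, Complex.re_sum, Complex.ofReal_re]
  rw [h1]
  simp only [map_add, LinearMap.add_apply, inner_add_right, Finset.sum_add_distrib, Complex.add_re]
  exact add_le_add (re_sum_inner_le_traceNorm X hh v.orthonormal.isBessel)
    (re_sum_inner_le_traceNorm Y hh v.orthonormal.isBessel)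

lemma traceNorm_neg (X : Matrix ι ι ℂ) : traceNorm (-X) = traceNorm X := by
  unfold traceNorm
  have : (-X)ᴴ * (-X) = Xᴴ * X := by simp
  congr! 4

/-- Cauchy-Schwarz for the singular values, whose squares sum to the trace of `Xᴴ * X`. -/
lemma traceNorm_sq_le (X : Matrix ι ι ℂ) :
    traceNorm X ^ 2 ≤ Fintype.card ι * ∑ i, ∑ j, ‖X i j‖ ^ 2 := by
  have hX := Matrix.isHermitian_conjTranspose_mul_self X
  have hnonneg : ∀ i, 0 ≤ hX.eigenvalues i :=
    eigenvalues_conjTranspose_mul_self_nonneg X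
  refine sq_sum_le_card_mul_sum_sq.trans (le_of_eq ?_)
  rw [Finset.card_univ]
  congr 1
  have htr := hX.trace_eq_sum_eigenvalues
  have h2 : (Xᴴ * X).trace = ((∑ i, ∑ j, ‖X i j‖ ^ 2 : ℝ) : ℂ) := by
    rw [Finset.sum_comm]
    simp only [Matrix.trace, Matrix.diag_apply, Matrix.mul_apply, Matrix.conjTranspose_apply]
    push_cast
    refine Finset.sum_congr rfl fun i _ => Finset.sum_congr rfl fun j _ => ?_
    rw [← Complex.conj_mul']
    rfl
  rw [h2] at htr
  have h3 : ∑ i, ∑ j, ‖X i j‖ ^ 2 = ∑ i, hX.eigenvalues i := by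
    apply Complex.ofReal_injective
    rw [htr]
    push_cast
    rfl
  rw [h3]
  exact Finset.sum_congr rfl fun i _ => Real.sq_sqrt (hnonneg i)

lemma traceNorm_nonneg (X : Matrix ι ι ℂ) : 0 ≤ traceNorm X :=
  Finset.sum_nonneg fun _ _ => Real.sqrt_nonneg _

lemma traceDist_triangle (ρ σ τ : Matrix ι ι ℂ) :
    traceDist ρ τ ≤ traceDist ρ σ + traceDist σ τ := by
  unfold traceDist
  have h := traceNorm_add_le (ρ - σ) (σ - τ)
  rw [sub_add_sub_cancel] at h
  linarith

lemma traceDist_comm (ρ σ : Matrix ι ι ℂ) : traceDist ρ σ = traceDist σ ρ := by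
  rw [traceDist, traceDist, ← traceNorm_neg, neg_sub]

lemma traceDist_self (ρ : Matrix ι ι ℂ) : traceDist ρ ρ = 0 := by
  have h := traceNorm_sq_le (ρ - ρ)
  simp only [sub_self, Matrix.zero_apply, norm_zero, ne_eq, OfNat.ofNat_ne_zero, not_false_eq_true,
    zero_pow, Finset.sum_const_zero, mul_zero] at h
  have h' : traceNorm (0 : Matrix ι ι ℂ) = 0 := by
    have := traceNorm_nonneg (0 : Matrix ι ι ℂ)
    nlinarith
  simp [traceDist, h']

end TraceNorm

/-! ### Distance from the maximally mixed state -/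

/-- For trace one, the squared Hilbert-Schmidt distance from the maximally mixed state is the
squared Hilbert-Schmidt norm minus 2^(-k). -/
lemma traceDist_maximallyMixed_sq_le {k : ℕ} (ρ : Matrix (Config k) (Config k) ℂ)
    (htr : ρ.trace = 1) :
    traceDist ρ (maximallyMixed k) ^ 2 ≤ (2 ^ k * (∑ x, ∑ y, ‖ρ x y‖ ^ 2) - 1) / 4 := by
  have h := traceNorm_sq_le (ρ - maximallyMixed k)
  have hcard : (Fintype.card (Config k) : ℝ) = 2 ^ k := by simp
  have hterm : ∀ x y : Config k, ‖(ρ - maximallyMixed k) x y‖ ^ 2 =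
      ‖ρ x y‖ ^ 2 + if x = y then ((2 ^ k)⁻¹ ^ 2 - 2 * (2 ^ k)⁻¹ * (ρ x x).re : ℝ) else 0 := by
    intro x y
    by_cases hxy : x = y
    · subst hxy
      have hz : (maximallyMixed k) x x = (((2 ^ k)⁻¹ : ℝ) : ℂ) := by
        simp [maximallyMixed]
      rw [Matrix.sub_apply, hz, if_pos rfl, ← Complex.normSq_eq_norm_sq, ← Complex.normSq_eq_norm_sq,
        Complex.normSq_apply, Complex.normSq_apply]
      simp only [Complex.sub_re, Complex.sub_im, Complex.ofReal_re, Complex.ofReal_im]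
      ring
    · simp [maximallyMixed, hxy]
  have htr' : ∑ x, (ρ x x).re = 1 := by
    have := congrArg Complex.re htr
    simpa [Matrix.trace] using this
  have hsum : ∑ x, ∑ y, ‖(ρ - maximallyMixed k) x y‖ ^ 2 = ∑ x, ∑ y, ‖ρ x y‖ ^ 2 - (2 ^ k)⁻¹ := by
    simp only [hterm, Finset.sum_add_distrib, Finset.sum_ite_eq, Finset.mem_univ, if_true,
      Finset.sum_sub_distrib, ← Finset.mul_sum, htr', Finset.sum_const, Finset.card_univ, nsmul_eq_mul,
      hcard]
    have : (2 : ℝ) ^ k ≠ 0 := by positivity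
    field_simp
    ring
  rw [hsum, hcard] at h
  have h2 : (2 : ℝ) ^ k * (2 ^ k)⁻¹ = 1 := mul_inv_cancel₀ (by positivity)
  rw [traceDist, div_pow]
  nlinarith

lemma trace_reducedState {N k : ℕ} (e : Fin k ↪ Fin N) (φ : Config N → ℂ) :
    (reducedState e (pureDensity φ)).trace = ((∑ x, ‖φ x‖ ^ 2 : ℝ) : ℂ) := by
  simp only [Matrix.trace, Matrix.diag_apply, reducedState_pureDensity]
  rw [sum_joinConfig e]
  push_cast
  refine Finset.sum_congr rfl fun i _ => Finset.sum_congr rfl fun j _ => ?_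
  rw [← Complex.mul_conj']
  rfl

lemma traceDist_reducedState_sq_le {N k : ℕ} (e : Fin k ↪ Fin N) {φ : Config N → ℂ}
    (hφ : ∑ x, ‖φ x‖ ^ 2 = 1) :
    traceDist (reducedState e (pureDensity φ)) (maximallyMixed k) ^ 2 ≤
      (2 ^ k * purity (Finset.univ.map e) φ - 1) / 4 := by
  rw [purity_map_univ]
  exact traceDist_maximallyMixed_sq_le _ (by rw [trace_reducedState, hφ, Complex.ofReal_one])

/-- Concentration of the reduced state of a random brickwork circuit. -/
theorem brickMeasure_traceDist_gt_le {m nA nB t : ℕ} (e : Fin nA ↪ Fin (2 * m))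
    {ψ : Config (2 * m) → ℂ} (hn : nA + nB = 2 * m) (hψ : ∑ x, ‖ψ x‖ ^ 2 = 1) {ε : ℝ}
    (hε : 0 < ε) :
    brickMeasure m (t + 1) {u | ε < traceDist (brickOutput e ψ u) (maximallyMixed nA)} ≤
      ENNReal.ofReal ((2 ^ nA * (1 / 2) ^ nB + 2 ^ nA * (4 / 5) ^ t) / (4 * ε ^ 2)) := by
  set S := Finset.univ.map e with hS
  have hcard : S.card = nA := by simp [hS]
  have hcard' : Sᶜ.card = nB := by
    rw [Finset.card_compl, hcard, Fintype.card_fin]; omega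
  set f : (Fin (t + 1) → Fin m → TwoQubitGate) → ℝ :=
    fun u => (2 ^ nA * purity S (brickCircuit u *ᵥ ψ) - 1) / 4 with hf
  have hfd : ∀ u, traceDist (brickOutput e ψ u) (maximallyMixed nA) ^ 2 ≤ f u := fun u =>
    traceDist_reducedState_sq_le e (by rw [norm_brickCircuit_mulVec, hψ])
  have hint : Integrable f (brickMeasure m (t + 1)) :=
    (((integrable_purity_brickCircuit ψ S).const_mul _).sub (integrable_const 1)).div_const 4
  have hval : ∫ u, f u ∂brickMeasure m (t + 1) ≤
      (2 ^ nA * (1 / 2) ^ nB + 2 ^ nA * (4 / 5) ^ t) / 4 := by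
    have h1 : ∫ u, f u ∂brickMeasure m (t + 1) = (2 ^ nA * meanPurity ψ (t + 1) S - 1) / 4 := by
      simp only [hf]
      rw [integral_div, integral_sub ((integrable_purity_brickCircuit ψ S).const_mul _)
        (integrable_const 1), integral_const_mul]
      simp [meanPurity]
    have h2 := meanPurity_succ_le_add hψ t S
    rw [hcard, hcard'] at h2
    -- The stationary term 2^(-nA) cancels the -1 exactly; only D_A/D_B and the depth error survive.
    have h3 : (2 : ℝ) ^ nA * (1 / 2) ^ nA = 1 := by rw [← mul_pow]; norm_num
    have h4 := mul_le_mul_of_nonneg_left h2 (by positivity : (0 : ℝ) ≤ 2 ^ nA)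
    rw [h1]
    linarith
  have hmarkov := mul_meas_ge_le_integral_of_nonneg
    (Filter.Eventually.of_forall fun u => (sq_nonneg _).trans (hfd u)) hint (ε ^ 2)
  have hε2 : 0 < ε ^ 2 := by positivity
  have hsub : {u | ε < traceDist (brickOutput e ψ u) (maximallyMixed nA)} ⊆ {u | ε ^ 2 ≤ f u} :=
    fun u hu => (pow_le_pow_left₀ hε.le (le_of_lt hu) 2).trans (hfd u)
  refine (measure_mono hsub).trans ?_
  rw [← ENNReal.ofReal_toReal (measure_ne_top (brickMeasure m (t + 1)) {u | ε ^ 2 ≤ f u})]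
  refine ENNReal.ofReal_le_ofReal ?_
  have := hmarkov.trans hval
  rw [le_div_iff₀ (by positivity)]
  rw [measureReal_def] at this
  linarith

end

/-! ### Independence of the complexity from a large register, and its linear bound. -/

noncomputable section

/-! ### Circuits on part of the register -/

lemma exists_joinConfig {N k : ℕ} (e : Fin k ↪ Fin N) (z : Config N) :
    ∃ a r, joinConfig e a r = z :=
  ⟨(splitEquiv e z).1, (splitEquiv e z).2, (splitEquiv e).left_inv z⟩

lemma joinConfig_inj {N k : ℕ} (e : Fin k ↪ Fin N) {a b : Config k} {r s : RestConfig e} :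
    joinConfig e a r = joinConfig e b s ↔ a = b ∧ r = s := by
  constructor
  · intro h
    have := (splitEquiv e).symm.injective (a₁ := (a, r)) (a₂ := (b, s)) h
    exact Prod.ext_iff.mp this
  · rintro ⟨rfl, rfl⟩; rfl

lemma joinConfig_zero {N k : ℕ} (e : Fin k ↪ Fin N) : joinConfig e 0 0 = 0 :=
  joinConfig_ext e (by simp) (fun i h => by simp [joinConfig_apply_of_notMem e _ _ h])

lemma embedGate_one {N k : ℕ} (e : Fin k ↪ Fin N) :
    embedGate e (1 : Matrix (Config k) (Config k) ℂ) = 1 := by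
  ext z w
  obtain ⟨a, r, rfl⟩ := exists_joinConfig e z
  obtain ⟨b, s, rfl⟩ := exists_joinConfig e w
  simp only [embedGate_joinConfig, Matrix.one_apply, joinConfig_inj]
  by_cases h1 : a = b <;> by_cases h2 : r = s <;> simp [h1, h2]

lemma embedGate_mul {N k : ℕ} (e : Fin k ↪ Fin N) (A B : Matrix (Config k) (Config k) ℂ) :
    embedGate e (A * B) = embedGate e A * embedGate e B := by
  ext z w
  obtain ⟨a, r, rfl⟩ := exists_joinConfig e z
  obtain ⟨b, s, rfl⟩ := exists_joinConfig e w
  rw [Matrix.mul_apply, sum_joinConfig e]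
  simp only [embedGate_joinConfig, Matrix.mul_apply, ite_mul, zero_mul, Finset.sum_ite_eq,
    Finset.mem_univ, if_true]
  split_ifs <;> simp

lemma embedGate_trans {N N' k : ℕ} (e : Fin k ↪ Fin N') (f : Fin N' ↪ Fin N)
    (u : Matrix (Config k) (Config k) ℂ) :
    embedGate (e.trans f) u = embedGate f (embedGate e u) := by
  ext z w
  have h : (∀ i, i ∉ Set.range (e.trans f) → z i = w i) ↔
      (∀ i, i ∉ Set.range f → z i = w i) ∧ ∀ j, j ∉ Set.range e → (z ∘ f) j = (w ∘ f) j := by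
    constructor
    · refine fun h => ⟨fun i hi => h i ?_, fun j hj => h (f j) ?_⟩
      · rintro ⟨j, rfl⟩; exact hi ⟨e j, rfl⟩
      · rintro ⟨l, hl⟩; exact hj ⟨l, f.injective hl⟩
    · rintro ⟨h1, h2⟩ i hi
      by_cases h : i ∈ Set.range f
      · obtain ⟨j, rfl⟩ := h
        refine h2 j ?_
        rintro ⟨l, rfl⟩; exact hi ⟨l, rfl⟩
      · exact h1 i h
  simp only [embedGate, h]
  rw [ite_and]
  rfl

variable {G : Set TwoQubitGate}

lemma IsCircuit.embed {N N' r : ℕ} {U : Matrix (Config N') (Config N') ℂ}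
    (h : IsCircuit G N' r U) (f : Fin N' ↪ Fin N) : IsCircuit G N r (embedGate f U) := by
  induction h with
  | nil => rw [embedGate_one]; exact .nil
  | cons g hg e _ ih =>
    rw [embedGate_mul, ← embedGate_trans]
    exact .cons g hg _ ih

lemma IsCircuit.mul {N r r' : ℕ} {U V : Matrix (Config N) (Config N) ℂ}
    (hU : IsCircuit G N r U) (hV : IsCircuit G N r' V) : IsCircuit G N (r + r') (V * U) := by
  induction hV with
  | nil => simpa using hU
  | cons g hg e _ ih =>
    rw [mul_assoc]
    exact .cons g hg e ih

/-- An embedding whose range lies in the range of `f` factors through `f`. -/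
lemma exists_trans_eq {N N' k : ℕ} {e : Fin k ↪ Fin N} {f : Fin N' ↪ Fin N}
    (h : ∀ i, e i ∈ Set.range f) : ∃ e' : Fin k ↪ Fin N', e = e'.trans f := by
  choose e' he' using h
  refine ⟨⟨e', fun i j hij => e.injective ?_⟩, ?_⟩
  · rw [← he' i, ← he' j, hij]
  · exact Function.Embedding.ext fun i => (he' i).symm

/-- A circuit of `r` gates acts on at most `2r` qubits. -/
lemma IsCircuit.exists_support {N r : ℕ} {U : Matrix (Config N) (Config N) ℂ}
    (h : IsCircuit G N r U) : ∃ S : Finset (Fin N), S.card ≤ 2 * r ∧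
      ∀ (N' : ℕ) (f : Fin N' ↪ Fin N), (∀ i ∈ S, i ∈ Set.range f) →
        ∃ U', IsCircuit G N' r U' ∧ U = embedGate f U' := by
  induction h with
  | nil => exact ⟨∅, by simp, fun N' f _ => ⟨1, .nil, (embedGate_one f).symm⟩⟩
  | @cons r U g hg e _ ih =>
    obtain ⟨S, hS, h⟩ := ih
    refine ⟨S ∪ Finset.univ.map e, ?_, fun N' f hf => ?_⟩
    · refine (Finset.card_union_le _ _).trans ?_
      simp only [Finset.card_map, Finset.card_univ, Fintype.card_fin]
      omega
    · obtain ⟨U', hU', rfl⟩ := h N' f fun i hi => hf i (Finset.mem_union_left _ hi)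
      obtain ⟨e', rfl⟩ := exists_trans_eq (e := e) (f := f)
        fun i => hf _ (Finset.mem_union_right _ (by simp))
      exact ⟨embedGate e' g.1 * U', .cons g hg e' hU', by rw [embedGate_mul, embedGate_trans]⟩

/-- Qubits outside the range of `f` stay in the state |0⟩ and drop out of the partial trace. -/
lemma reducedState_trans_embedGate {N N' k : ℕ} (e : Fin k ↪ Fin N') (f : Fin N' ↪ Fin N)
    (U : Matrix (Config N') (Config N') ℂ) :
    reducedState (e.trans f) (pureDensity (embedGate f U *ᵥ zeroKet N)) =
      reducedState e (pureDensity (U *ᵥ zeroKet N')) := by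
  classical
  have hz : ∀ a r, (embedGate f U *ᵥ zeroKet N) (joinConfig f a r) =
      if r = 0 then (U *ᵥ zeroKet N') a else 0 := by
    intro a r
    rw [embedGate_mulVec_joinConfig]
    have : ∀ b, zeroKet N (joinConfig f b r) = if r = 0 then zeroKet N' b else 0 := by
      intro b
      have h0 : joinConfig f b r = 0 ↔ b = 0 ∧ r = 0 := by
        rw [← joinConfig_zero f, joinConfig_inj]
      simp only [zeroKet, Pi.single_apply, h0]
      by_cases h1 : b = 0 <;> by_cases h2 : r = 0 <;> simp [h1, h2]
    simp only [this, Matrix.mulVec, dotProduct]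
    split_ifs <;> simp
  have hcond : ∀ a b : Config N',
      (∀ i, i ∉ Set.range (e.trans f) → joinConfig f a 0 i = joinConfig f b 0 i) ↔
        ∀ j, j ∉ Set.range e → a j = b j := by
    intro a b
    constructor
    · intro h j hj
      have := h (f j) (by rintro ⟨l, hl⟩; exact hj ⟨l, f.injective hl⟩)
      simpa using this
    · intro h i hi
      by_cases h' : i ∈ Set.range f
      · obtain ⟨j, rfl⟩ := h'
        simpa using h j (by rintro ⟨l, rfl⟩; exact hi ⟨l, rfl⟩)
      · rw [joinConfig_apply_of_notMem f _ _ h', joinConfig_apply_of_notMem f _ _ h']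
  have hcomp : ∀ a r, joinConfig f a r ∘ (e.trans f) = a ∘ e := by
    intro a r; funext i; simp
  funext x y
  simp only [reducedState, pureDensity, Matrix.vecMulVec_apply, Pi.star_apply]
  rw [sum_joinConfig f]
  refine Finset.sum_congr rfl fun a _ => ?_
  rw [Finset.sum_eq_single 0 _ (by simp)]
  · rw [sum_joinConfig f]
    refine Finset.sum_congr rfl fun b _ => ?_
    rw [Finset.sum_eq_single 0 _ (by simp)]
    · simp only [hz, hcond, hcomp, if_true]
    · intro s _ hs
      simp [hz, hs]
  · intro r _ hr
    simp [hz, hr]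

/-! ### Mixed state complexity -/

/-- Some circuit of `r` gates on `N` qubits prepares `ρ` up to trace distance `δ`. -/
def Preparable (G : Set TwoQubitGate) (N : ℕ) (δ : ℝ) {k : ℕ}
    (ρ : Matrix (Config k) (Config k) ℂ) (r : ℕ) : Prop :=
  ∃ U : Matrix (Config N) (Config N) ℂ, IsCircuit G N r U ∧
    ∃ e : Fin k ↪ Fin N, traceDist ρ (reducedState e (pureDensity (U *ᵥ zeroKet N))) ≤ δ

lemma mixedComplexity_eq_sInf (G : Set TwoQubitGate) (N : ℕ) (δ : ℝ) {k : ℕ}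
    (ρ : Matrix (Config k) (Config k) ℂ) : mixedComplexity G N δ ρ =
      sInf {s : ℕ∞ | ∃ r : ℕ, s = (r : ℕ∞) ∧ Preparable G N δ ρ r} := rfl

lemma mixedComplexity_le_iff {N : ℕ} {δ : ℝ} {k : ℕ}
    {ρ : Matrix (Config k) (Config k) ℂ} {s : ℕ} :
    mixedComplexity G N δ ρ ≤ (s : ℕ∞) ↔ ∃ r ≤ s, Preparable G N δ ρ r := by
  rw [mixedComplexity_eq_sInf]
  constructor
  · intro h
    have hne : {s : ℕ∞ | ∃ r : ℕ, s = (r : ℕ∞) ∧ Preparable G N δ ρ r}.Nonempty := by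
      by_contra hne
      rw [Set.not_nonempty_iff_eq_empty.mp hne, sInf_empty] at h
      exact absurd h (by simp)
    obtain ⟨r, hr, hp⟩ := csInf_mem hne
    rw [hr] at h
    exact ⟨r, by exact_mod_cast h, hp⟩
  · rintro ⟨r, hr, hp⟩
    exact le_trans (b := (r : ℕ∞)) (sInf_le ⟨r, rfl, hp⟩) (by exact_mod_cast hr)

lemma Preparable.mono {N : ℕ} {δ δ' : ℝ} {k : ℕ} {ρ σ : Matrix (Config k) (Config k) ℂ} {r : ℕ}
    (h : Preparable G N δ ρ r) (hd : traceDist σ ρ + δ ≤ δ') : Preparable G N δ' σ r := by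
  obtain ⟨U, hU, e, he⟩ := h
  refine ⟨U, hU, e, (traceDist_triangle σ ρ _).trans ?_⟩
  linarith

lemma mixedComplexity_le_of_traceDist (G : Set TwoQubitGate) (N : ℕ) {δ δ' : ℝ} {k : ℕ}
    {ρ σ : Matrix (Config k) (Config k) ℂ} (hd : traceDist σ ρ + δ ≤ δ') :
    mixedComplexity G N δ' σ ≤ mixedComplexity G N δ ρ := by
  rw [mixedComplexity_eq_sInf, mixedComplexity_eq_sInf]
  refine sInf_le_sInf ?_
  rintro s ⟨r, rfl, hp⟩
  exact ⟨r, rfl, hp.mono hd⟩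

lemma Preparable.of_le {N N' : ℕ} {δ : ℝ} {k : ℕ} {ρ : Matrix (Config k) (Config k) ℂ} {r : ℕ}
    (h : Preparable G N' δ ρ r) (hN : N' ≤ N) : Preparable G N δ ρ r := by
  obtain ⟨U, hU, e, he⟩ := h
  refine ⟨_, hU.embed (Fin.castLEEmb hN), e.trans (Fin.castLEEmb hN), ?_⟩
  rwa [reducedState_trans_embedGate]

/-- At most 2r qubits are touched and k are read out, so the register can be cut down to any size
that holds these. -/
lemma Preparable.of_card_le {N N' : ℕ} {δ : ℝ} {k : ℕ} {ρ : Matrix (Config k) (Config k) ℂ}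
    {r : ℕ} (h : Preparable G N δ ρ r) (hN' : k + 2 * r ≤ N') : Preparable G N' δ ρ r := by
  rcases le_total N N' with hle | hN
  · exact h.of_le hle
  obtain ⟨U, hU, e, he⟩ := h
  obtain ⟨S, hS, hf⟩ := hU.exists_support
  have hcard : (S ∪ Finset.univ.map e).card ≤ N' := by
    refine (Finset.card_union_le _ _).trans ?_
    simp only [Finset.card_map, Finset.card_univ, Fintype.card_fin]
    omega
  obtain ⟨R, hR, hRcard⟩ := Finset.exists_superset_card_eq hcard (by simpa using hN)
  set f : Fin N' ↪ Fin N := (R.orderEmbOfFin hRcard).toEmbedding with hfdef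
  have hrange : ∀ i ∈ R, i ∈ Set.range f := by
    intro i hi
    have : Set.range (R.orderEmbOfFin hRcard) = R := Finset.range_orderEmbOfFin R hRcard
    rw [← Finset.mem_coe, ← this] at hi
    exact hi
  obtain ⟨U', hU', rfl⟩ := hf N' f fun i hi => hrange i (hR (Finset.mem_union_left _ hi))
  obtain ⟨e', rfl⟩ := exists_trans_eq (e := e) (f := f)
    fun i => hrange _ (hR (Finset.mem_union_right _ (by simp)))
  refine ⟨U', hU', e', ?_⟩
  rwa [reducedState_trans_embedGate] at he

/-- Registers with room for all gates and the output are equivalent. -/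
lemma mixedComplexity_le_iff_of_card_le {N N' : ℕ} {δ : ℝ} {k s : ℕ}
    {ρ : Matrix (Config k) (Config k) ℂ} (hN : k + 2 * s ≤ N) (hN' : k + 2 * s ≤ N') :
    mixedComplexity G N δ ρ ≤ (s : ℕ∞) ↔ mixedComplexity G N' δ ρ ≤ (s : ℕ∞) := by
  rw [mixedComplexity_le_iff, mixedComplexity_le_iff]
  exact ⟨fun ⟨r, hr, h⟩ => ⟨r, hr, h.of_card_le (by omega)⟩,
    fun ⟨r, hr, h⟩ => ⟨r, hr, h.of_card_le (by omega)⟩⟩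

/-! ### Products of states -/

lemma sum_append {N M : ℕ} {α : Type*} [AddCommMonoid α] (f : Config (N + M) → α) :
    ∑ z, f z = ∑ a : Config N, ∑ b : Config M, f (Fin.append a b) := by
  rw [← (Fin.appendEquiv N M).sum_comp f, Fintype.sum_prod_type]
  rfl

lemma exists_append {N M : ℕ} (z : Config (N + M)) :
    ∃ (a : Config N) (b : Config M), Fin.append a b = z :=
  ⟨_, _, Fin.append_castAdd_natAdd⟩

lemma append_inj {N M : ℕ} {a a' : Config N} {b b' : Config M} :
    Fin.append a b = Fin.append a' b' ↔ a = a' ∧ b = b' := by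
  constructor
  · intro h
    exact Prod.ext_iff.mp ((Fin.appendEquiv N M).injective (a₁ := (a, b)) (a₂ := (a', b')) h)
  · rintro ⟨rfl, rfl⟩; rfl

/-- The product state. -/
def prodKet {N M : ℕ} (φ : Config N → ℂ) (χ : Config M → ℂ) : Config (N + M) → ℂ :=
  fun z => φ (z ∘ Fin.castAdd M) * χ (z ∘ Fin.natAdd N)

@[simp] lemma append_comp_castAdd {N M : ℕ} (a : Config N) (b : Config M) :
    Fin.append a b ∘ Fin.castAdd M = a := funext fun i => Fin.append_left a b i

@[simp] lemma append_comp_natAdd {N M : ℕ} (a : Config N) (b : Config M) :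
    Fin.append a b ∘ Fin.natAdd N = b := funext fun i => Fin.append_right a b i

@[simp] lemma prodKet_append {N M : ℕ} (φ : Config N → ℂ) (χ : Config M → ℂ) (a : Config N)
    (b : Config M) : prodKet φ χ (Fin.append a b) = φ a * χ b := by
  simp [prodKet]

lemma zeroKet_add (N M : ℕ) : zeroKet (N + M) = prodKet (zeroKet N) (zeroKet M) := by
  funext z
  obtain ⟨a, b, rfl⟩ := exists_append z
  have h0 : (0 : Config (N + M)) = Fin.append 0 0 := by
    refine Fin.addCases (fun i => ?_) (fun i => ?_) |> funext <;> simp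
  have h : Fin.append a b = 0 ↔ a = 0 ∧ b = 0 := by rw [h0, append_inj]
  simp only [prodKet_append, zeroKet, Pi.single_apply, h]
  by_cases h1 : a = 0 <;> by_cases h2 : b = 0 <;> simp [h1, h2]

lemma forall_notMem_range_castAddEmb {N M : ℕ} {p : Fin (N + M) → Prop} :
    (∀ i, i ∉ Set.range (Fin.castAddEmb M : Fin N ↪ Fin (N + M)) → p i) ↔
      ∀ j : Fin M, p (Fin.natAdd N j) := by
  constructor
  · intro h j
    refine h _ ?_
    rintro ⟨i, hi⟩
    have := congrArg Fin.val hi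
    simp at this
    omega
  · intro h i hi
    induction i using Fin.addCases with
    | left i => exact absurd ⟨i, rfl⟩ hi
    | right j => exact h j

lemma forall_notMem_range_natAddEmb {N M : ℕ} {p : Fin (N + M) → Prop} :
    (∀ i, i ∉ Set.range (Fin.natAddEmb N : Fin M ↪ Fin (N + M)) → p i) ↔
      ∀ j : Fin N, p (Fin.castAdd M j) := by
  constructor
  · intro h j
    refine h _ ?_
    rintro ⟨i, hi⟩
    have := congrArg Fin.val hi
    simp at this
    omega
  · intro h i hi
    induction i using Fin.addCases with
    | left i => exact h i
    | right j => exact absurd ⟨j, rfl⟩ hi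

lemma embedGate_castAddEmb_mulVec {N M : ℕ} (A : Matrix (Config N) (Config N) ℂ)
    (φ : Config N → ℂ) (χ : Config M → ℂ) :
    embedGate (Fin.castAddEmb M) A *ᵥ prodKet φ χ = prodKet (A *ᵥ φ) χ := by
  funext z
  obtain ⟨a, b, rfl⟩ := exists_append z
  simp only [Matrix.mulVec, dotProduct]
  rw [sum_append]
  have h : ∀ a' b', embedGate (Fin.castAddEmb M) A (Fin.append a b) (Fin.append a' b') =
      if b = b' then A a a' else 0 := by
    intro a' b'
    have hc : (∀ i, i ∉ Set.range (Fin.castAddEmb M : Fin N ↪ Fin (N + M)) →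
        Fin.append a b i = Fin.append a' b' i) ↔ b = b' := by
      rw [forall_notMem_range_castAddEmb (p := fun i => Fin.append a b i = Fin.append a' b' i)]
      simp [funext_iff]
    exact if_congr hc (congrArg₂ A (append_comp_castAdd a b) (append_comp_castAdd a' b')) rfl
  simp [h, Finset.sum_mul, mul_assoc, prodKet, Matrix.mulVec, dotProduct]

lemma embedGate_natAddEmb_mulVec {N M : ℕ} (A : Matrix (Config M) (Config M) ℂ)
    (φ : Config N → ℂ) (χ : Config M → ℂ) :
    embedGate (Fin.natAddEmb N) A *ᵥ prodKet φ χ = prodKet φ (A *ᵥ χ) := by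
  funext z
  obtain ⟨a, b, rfl⟩ := exists_append z
  simp only [Matrix.mulVec, dotProduct]
  rw [sum_append]
  have h : ∀ a' b', embedGate (Fin.natAddEmb N) A (Fin.append a b) (Fin.append a' b') =
      if a = a' then A b b' else 0 := by
    intro a' b'
    have hc : (∀ i, i ∉ Set.range (Fin.natAddEmb N : Fin M ↪ Fin (N + M)) →
        Fin.append a b i = Fin.append a' b' i) ↔ a = a' := by
      rw [forall_notMem_range_natAddEmb (p := fun i => Fin.append a b i = Fin.append a' b' i)]
      simp [funext_iff]
    exact if_congr hc (congrArg₂ A (append_comp_natAdd a b) (append_comp_natAdd a' b')) rfl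
  rw [Finset.sum_comm]
  simp [h, Finset.mul_sum, prodKet, Matrix.mulVec, dotProduct, mul_left_comm]

/-- The disjoint union of two embeddings. -/
def sumEmb {N M k l : ℕ} (e : Fin k ↪ Fin N) (f : Fin l ↪ Fin M) : Fin (k + l) ↪ Fin (N + M) where
  toFun := Fin.append (fun i => Fin.castAdd M (e i)) (fun j => Fin.natAdd N (f j))
  inj' := by
    intro i j h
    induction i using Fin.addCases <;> induction j using Fin.addCases <;>
      simp only [Fin.append_left, Fin.append_right] at h
    · rw [e.injective (Fin.castAdd_injective _ _ h)]
    · have := congrArg Fin.val h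
      simp at this; omega
    · have := congrArg Fin.val h
      simp at this; omega
    · rw [f.injective (Fin.natAdd_injective _ _ h)]

@[simp] lemma sumEmb_castAdd {N M k l : ℕ} (e : Fin k ↪ Fin N) (f : Fin l ↪ Fin M) (i : Fin k) :
    sumEmb e f (Fin.castAdd l i) = Fin.castAdd M (e i) :=
  Fin.append_left (fun i => Fin.castAdd M (e i)) (fun j => Fin.natAdd N (f j)) i

@[simp] lemma sumEmb_natAdd {N M k l : ℕ} (e : Fin k ↪ Fin N) (f : Fin l ↪ Fin M) (j : Fin l) :
    sumEmb e f (Fin.natAdd k j) = Fin.natAdd N (f j) :=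
  Fin.append_right (fun i => Fin.castAdd M (e i)) (fun j => Fin.natAdd N (f j)) j

lemma append_comp_sumEmb {N M k l : ℕ} (e : Fin k ↪ Fin N) (f : Fin l ↪ Fin M) (a : Config N)
    (b : Config M) : Fin.append a b ∘ sumEmb e f = Fin.append (a ∘ e) (b ∘ f) := by
  funext i
  induction i using Fin.addCases <;> simp

lemma forall_notMem_range_sumEmb {N M k l : ℕ} (e : Fin k ↪ Fin N) (f : Fin l ↪ Fin M)
    {p : Fin (N + M) → Prop} : (∀ i, i ∉ Set.range (sumEmb e f) → p i) ↔
      (∀ i, i ∉ Set.range e → p (Fin.castAdd M i)) ∧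
        ∀ j, j ∉ Set.range f → p (Fin.natAdd N j) := by
  constructor
  · refine fun h => ⟨fun i hi => h _ ?_, fun j hj => h _ ?_⟩
    · rintro ⟨x, hx⟩
      induction x using Fin.addCases with
      | left x => exact hi ⟨x, Fin.castAdd_injective N M (by simpa using hx)⟩
      | right x =>
        have := congrArg Fin.val hx
        simp at this
        omega
    · rintro ⟨x, hx⟩
      induction x using Fin.addCases with
      | left x =>
        have := congrArg Fin.val hx
        simp at this
        omega
      | right x => exact hj ⟨x, Fin.natAdd_injective M N (by simpa using hx)⟩
  · rintro ⟨h1, h2⟩ i hi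
    induction i using Fin.addCases with
    | left i =>
      refine h1 i ?_
      rintro ⟨x, rfl⟩
      exact hi ⟨Fin.castAdd l x, by simp⟩
    | right j =>
      refine h2 j ?_
      rintro ⟨x, rfl⟩
      exact hi ⟨Fin.natAdd k x, by simp⟩

lemma reducedState_sumEmb {N M k l : ℕ} (e : Fin k ↪ Fin N) (f : Fin l ↪ Fin M)
    (φ : Config N → ℂ) (χ : Config M → ℂ) (x x' : Config k) (y y' : Config l) :
    reducedState (sumEmb e f) (pureDensity (prodKet φ χ)) (Fin.append x y) (Fin.append x' y') =
      reducedState e (pureDensity φ) x x' * reducedState f (pureDensity χ) y y' := by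
  classical
  simp only [reducedState, pureDensity, Matrix.vecMulVec_apply, Pi.star_apply]
  rw [sum_append, Finset.sum_mul_sum]
  refine Finset.sum_congr rfl fun a _ => Finset.sum_congr rfl fun b _ => ?_
  rw [sum_append, Finset.sum_mul_sum]
  refine Finset.sum_congr rfl fun a' _ => Finset.sum_congr rfl fun b' _ => ?_
  simp only [append_comp_sumEmb, append_inj, forall_notMem_range_sumEmb, Fin.append_left,
    Fin.append_right, prodKet_append, star_mul', ite_mul, mul_ite, zero_mul, mul_zero, ← ite_and]
  refine if_congr (by tauto) (by ring) rfl

lemma maximallyMixed_add {k l : ℕ} (x x' : Config k) (y y' : Config l) :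
    maximallyMixed (k + l) (Fin.append x y) (Fin.append x' y') =
      maximallyMixed k x x' * maximallyMixed l y y' := by
  simp only [maximallyMixed, Matrix.smul_apply, Matrix.one_apply, append_inj, smul_eq_mul,
    pow_add, mul_inv]
  by_cases h1 : x = x' <;> by_cases h2 : y = y' <;> simp [h1, h2]

lemma exists_prepares_maximallyMixed {r : ℕ} {U : Matrix (Config 2) (Config 2) ℂ}
    (hU : IsCircuit G 2 r U) {e : Fin 1 ↪ Fin 2}
    (he : reducedState e (pureDensity (U *ᵥ zeroKet 2)) = maximallyMixed 1) (k : ℕ) :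
    ∃ V : Matrix (Config (2 * k)) (Config (2 * k)) ℂ, IsCircuit G (2 * k) (r * k) V ∧
      ∃ f : Fin k ↪ Fin (2 * k),
        reducedState f (pureDensity (V *ᵥ zeroKet (2 * k))) = maximallyMixed k := by
  induction k with
  | zero =>
    refine ⟨1, .nil, Function.Embedding.refl _, ?_⟩
    ext x y
    rw [reducedState_pureDensity, Subsingleton.elim y x]
    have : IsEmpty (Fin (2 * 0)) := inferInstanceAs (IsEmpty (Fin 0))
    have hz : ∀ z : Config (2 * 0), zeroKet (2 * 0) z = 1 := fun z => by
      rw [Subsingleton.elim z 0, zeroKet, Pi.single_eq_same]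
    simp [maximallyMixed, hz]
  | succ k ih =>
    obtain ⟨V, hV, f, hf⟩ := ih
    -- One more EPR pair on two fresh qubits; the chosen half of it joins the output.
    refine ⟨embedGate (Fin.natAddEmb (2 * k)) U * embedGate (Fin.castAddEmb 2) V,
      (hV.embed (Fin.castAddEmb 2)).mul (hU.embed (Fin.natAddEmb (2 * k))), sumEmb f e, ?_⟩
    ext x y
    change Config (k + 1) at x y
    obtain ⟨x1, x2, rfl⟩ := exists_append x
    obtain ⟨y1, y2, rfl⟩ := exists_append y
    rw [← Matrix.mulVec_mulVec]
    have hz : zeroKet (2 * (k + 1)) = prodKet (zeroKet (2 * k)) (zeroKet 2) := zeroKet_add _ _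
    rw [hz, embedGate_castAddEmb_mulVec, embedGate_natAddEmb_mulVec, reducedState_sumEmb, hf, he,
      maximallyMixed_add]

/-- The maximally mixed state is prepared from EPR pairs. -/
theorem PreparesEPR.exists_mixedComplexity_le (hG : PreparesEPR G) :
    ∃ K : ℕ, ∀ (k N : ℕ) (δ : ℝ), 2 * k ≤ N → 0 ≤ δ →
      mixedComplexity G N δ (maximallyMixed k) ≤ ((K * k : ℕ) : ℕ∞) := by
  obtain ⟨r, U, hU, e, he⟩ := hG
  refine ⟨r, fun k N δ hN hδ => mixedComplexity_le_iff.mpr ⟨r * k, le_rfl, ?_⟩⟩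
  obtain ⟨V, hV, f, hf⟩ := exists_prepares_maximallyMixed hU he k
  exact Preparable.of_le ⟨V, hV, f, by rw [hf, traceDist_self]; exact hδ⟩ hN

end

/-! ### Generic tolerances and the final estimates. -/

noncomputable section

/-! ### Avoiding the jumps of the complexity -/

/-- Almost every real number keeps a distance from countably many points proportional to summable
radii. -/
lemma ae_exists_forall_mul_lt_dist {ι : Type*} [Countable ι] (τ s : ι → ℝ) (hs : Summable s)
    (h0 : ∀ i, 0 ≤ s i) : ∀ᵐ δ : ℝ, ∃ a : ℝ, 0 < a ∧ ∀ i, a * s i < |δ - τ i| := by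
  have hvol : ∀ n : ℕ, volume {δ : ℝ | ¬ ∃ a : ℝ, 0 < a ∧ ∀ i, a * s i < |δ - τ i|} ≤
      ENNReal.ofReal (2 * ((1 / 2) ^ n * ∑' i, s i)) := by
    intro n
    have hsub : {δ : ℝ | ¬ ∃ a : ℝ, 0 < a ∧ ∀ i, a * s i < |δ - τ i|} ⊆
        ⋃ i, Metric.closedBall (τ i) ((1 / 2) ^ n * s i) := by
      intro δ hδ
      -- An exceptional δ violates the bound for every a > 0, in particular for a = 2^(-n), so the
      -- exceptional set has arbitrarily small covers.
      have : ¬ ∀ i, (1 / 2) ^ n * s i < |δ - τ i| := fun h => hδ ⟨_, by positivity, h⟩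
      push Not at this
      obtain ⟨i, hi⟩ := this
      exact Set.mem_iUnion.mpr ⟨i, by rwa [Metric.mem_closedBall, Real.dist_eq]⟩
    refine (measure_mono hsub).trans ((measure_iUnion_le _).trans ?_)
    simp only [Real.volume_closedBall]
    rw [← tsum_mul_left, ← tsum_mul_left,
      ENNReal.ofReal_tsum_of_nonneg (fun i => by have := h0 i; positivity)
        ((hs.mul_left _).mul_left _)]
  have hlim : Filter.Tendsto (fun n : ℕ => ENNReal.ofReal (2 * ((1 / 2) ^ n * ∑' i, s i)))
      Filter.atTop (nhds 0) := by
    have h1 : Filter.Tendsto (fun n : ℕ => 2 * ((1 / 2 : ℝ) ^ n * ∑' i, s i)) Filter.atTop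
        (nhds (2 * (0 * ∑' i, s i))) :=
      ((tendsto_pow_atTop_nhds_zero_of_lt_one (by norm_num) (by norm_num)).mul_const _).const_mul _
    have h2 := ENNReal.tendsto_ofReal h1
    simpa using h2
  rw [ae_iff]
  exact le_antisymm (ge_of_tendsto' hlim hvol) zero_le

/-- Let k be the value at δ + ε. Its threshold is at most δ + ε and not within ε of δ, hence below δ
- ε, so the value at δ - ε is already at most k. The bound B limits the thresholds to be avoided. -/
lemma le_of_forall_lt_dist_threshold {f : ℝ → ℕ∞} (hf : Antitone f) {B : ℕ}
    (hB : ∀ x, 0 ≤ x → f x ≤ B) {δ ε : ℝ} (hδ : 0 < δ) (hε : 0 ≤ ε)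
    (h : ∀ k ≤ B, ε < |δ - sInf {x | 0 ≤ x ∧ f x ≤ (k : ℕ)}|) :
    f (δ - ε) ≤ f (δ + ε) := by
  have hδε : 0 ≤ δ + ε := by positivity
  obtain ⟨k, hk⟩ := ENat.ne_top_iff_exists.mp (ne_top_of_le_ne_top (ENat.natCast_ne_top B) (hB _ hδε))
  have hkB : k ≤ B := by
    have := hB _ hδε
    rw [← hk] at this
    exact_mod_cast this
  have hmem : δ + ε ∈ {x | 0 ≤ x ∧ f x ≤ (k : ℕ)} := ⟨hδε, hk.symm.le⟩
  have hle : sInf {x | 0 ≤ x ∧ f x ≤ (k : ℕ)} ≤ δ + ε := csInf_le ⟨0, fun x hx => hx.1⟩ hmem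
  have hlt : sInf {x | 0 ≤ x ∧ f x ≤ (k : ℕ)} < δ - ε := by
    rcases lt_abs.mp (h k hkB) with h1 | h1 <;> linarith
  obtain ⟨x, hx, hxlt⟩ := exists_lt_of_csInf_lt ⟨_, hmem⟩ hlt
  rw [← hk]
  exact (hf hxlt.le).trans hx.2

lemma mixedComplexity_antitone (G : Set TwoQubitGate) (N : ℕ) {k : ℕ}
    (ρ : Matrix (Config k) (Config k) ℂ) : Antitone fun δ => mixedComplexity G N δ ρ :=
  fun δ δ' h => mixedComplexity_le_of_traceDist G N (by rw [traceDist_self]; linarith)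

/-- The smallest tolerance for which the maximally mixed state has complexity at most `s`. -/
def threshold (G : Set TwoQubitGate) (N k s : ℕ) : ℝ :=
  sInf {x : ℝ | 0 ≤ x ∧ mixedComplexity G N x (maximallyMixed k) ≤ (s : ℕ∞)}

lemma threshold_eq_of_card_le {G : Set TwoQubitGate} {N N' k s : ℕ} (hN : k + 2 * s ≤ N)
    (hN' : k + 2 * s ≤ N') : threshold G N k s = threshold G N' k s := by
  simp only [threshold, mixedComplexity_le_iff_of_card_le hN hN']

lemma mixedComplexity_sandwich (G : Set TwoQubitGate) (N : ℕ) {k : ℕ} {δ ε : ℝ}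
    {ρ σ : Matrix (Config k) (Config k) ℂ} (h : traceDist ρ σ ≤ ε) :
    mixedComplexity G N (δ + ε) σ ≤ mixedComplexity G N δ ρ ∧
      mixedComplexity G N δ ρ ≤ mixedComplexity G N (δ - ε) σ :=
  ⟨mixedComplexity_le_of_traceDist G N (by rw [traceDist_comm]; linarith),
    mixedComplexity_le_of_traceDist G N (by linarith)⟩

lemma mixedComplexity_eq_of_threshold {G : Set TwoQubitGate} {N k B : ℕ}
    (hB : ∀ x : ℝ, 0 ≤ x → mixedComplexity G N x (maximallyMixed k) ≤ (B : ℕ∞)) {δ ε : ℝ}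
    (hδ : 0 < δ) (hε : 0 ≤ ε) (h : ∀ s ≤ B, ε < |δ - threshold G N k s|)
    {ρ : Matrix (Config k) (Config k) ℂ} (hρ : traceDist ρ (maximallyMixed k) ≤ ε) :
    mixedComplexity G N δ ρ = mixedComplexity G N δ (maximallyMixed k) := by
  have hanti := mixedComplexity_antitone G N (maximallyMixed k)
  have key := le_of_forall_lt_dist_threshold hanti hB hδ hε h
  obtain ⟨h1, h2⟩ := mixedComplexity_sandwich G N (δ := δ) hρ
  have h3 : mixedComplexity G N (δ + ε) (maximallyMixed k) ≤
      mixedComplexity G N δ (maximallyMixed k) := hanti (by linarith)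
  have h4 : mixedComplexity G N δ (maximallyMixed k) ≤
      mixedComplexity G N (δ - ε) (maximallyMixed k) := hanti (by linarith)
  exact le_antisymm (h2.trans (key.trans h3)) (h4.trans (key.trans h1))

/-! ### Summable radii -/

/-- The index is (n_A, d) with d = n_B - n_A, which fixes the register, and a complexity level. The
K n_A + 1 levels cost one power, leaving the summable exponent -5/4. -/
lemma summable_register_radii (K : ℕ) :
    Summable fun i : Σ p : ℕ × ℕ, Fin (K * p.1 + 1) =>
      ((i.1.1 : ℝ) + 1) ^ (-(9 / 4) : ℝ) * ((2 : ℝ) ^ (-(1 / 20) : ℝ)) ^ i.1.2 := by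
  rw [summable_sigma_of_nonneg (fun i => by positivity)]
  refine ⟨fun p => (hasSum_fintype _).summable, ?_⟩
  simp only [tsum_fintype, Finset.sum_const, Finset.card_univ, Fintype.card_fin, nsmul_eq_mul]
  have h1 : Summable fun n : ℕ => ((K : ℝ) + 1) * ((n : ℝ) + 1) ^ (-(5 / 4) : ℝ) := by
    refine Summable.mul_left _ ?_
    have := (summable_nat_add_iff 1).mpr (Real.summable_nat_rpow.mpr (by norm_num : (-(5 / 4) : ℝ) < -1))
    simpa using this
  have h2 : Summable fun d : ℕ => ((2 : ℝ) ^ (-(1 / 20) : ℝ)) ^ d :=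
    summable_geometric_of_lt_one (by positivity)
      (Real.rpow_lt_one_of_one_lt_of_neg (by norm_num) (by norm_num))
  refine Summable.of_nonneg_of_le (fun p => by positivity) (fun p => ?_)
    (h1.mul_of_nonneg h2 (fun n => by positivity) (fun d => by positivity))
  rw [← mul_assoc]
  refine mul_le_mul_of_nonneg_right ?_ (by positivity)
  have h3 : ((p.1 : ℝ) + 1) ^ (-(5 / 4) : ℝ) = ((p.1 : ℝ) + 1) * ((p.1 : ℝ) + 1) ^ (-(9 / 4) : ℝ) := by
    rw [← Real.rpow_one_add' (by positivity) (by norm_num)]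
    norm_num
  rw [h3, ← mul_assoc]
  refine mul_le_mul_of_nonneg_right ?_ (by positivity)
  push_cast
  nlinarith [(Nat.cast_nonneg p.1 : (0 : ℝ) ≤ p.1), (Nat.cast_nonneg K : (0 : ℝ) ≤ K)]

/-- The index is n_A, a level, and a register size cut off at (2K + 1) n_A: quadratically many terms
against a geometric factor. -/
lemma summable_depth_radii (K : ℕ) :
    Summable fun i : Σ n : ℕ, Fin (K * n + 1) × Fin ((2 * K + 1) * n + 1) =>
      ((1 / 2 : ℝ)) ^ i.1 := by
  rw [summable_sigma_of_nonneg (fun i => by positivity)]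
  refine ⟨fun p => (hasSum_fintype _).summable, ?_⟩
  simp only [tsum_fintype, Finset.sum_const, Finset.card_univ, Fintype.card_fin, nsmul_eq_mul,
    Fintype.card_prod]
  have h1 : Summable fun n : ℕ => (2 * (2 * (K : ℝ) + 1) ^ 2) *
      (((n + 1 : ℕ) : ℝ) ^ 2 * (1 / 2 : ℝ) ^ (n + 1)) :=
    ((summable_nat_add_iff (f := fun n : ℕ => (n : ℝ) ^ 2 * (1 / 2 : ℝ) ^ n) 1).mpr
      (summable_pow_mul_geometric_of_norm_lt_one 2
      (by norm_num : ‖(1 / 2 : ℝ)‖ < 1))).mul_left _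
  refine Summable.of_nonneg_of_le (fun p => by positivity) (fun n => ?_) h1
  have h2 : (2 * (2 * (K : ℝ) + 1) ^ 2) * (((n + 1 : ℕ) : ℝ) ^ 2 * (1 / 2 : ℝ) ^ (n + 1)) =
      ((2 * (K : ℝ) + 1) ^ 2 * ((n : ℝ) + 1) ^ 2) * (1 / 2 : ℝ) ^ n := by
    push_cast; ring
  rw [h2]
  refine mul_le_mul_of_nonneg_right ?_ (by positivity)
  have hn : (0 : ℝ) ≤ n := Nat.cast_nonneg n
  have hK : (0 : ℝ) ≤ K := Nat.cast_nonneg K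
  push_cast
  rw [← mul_pow, sq]
  refine mul_le_mul ?_ ?_ (by positivity) (by positivity) <;> nlinarith [mul_nonneg hn hK]

/-- Split the exponent 1/2 = 9/20 + 1/20. The first part is spent on the hypothesis, with 5 · 9/20 =
9/4 > 2; the second keeps decay in d. -/
lemma sqrt_inv_two_pow_le {n d T : ℕ} (h : (2 : ℝ) ^ T * ((n : ℝ) + 1) ^ 5 ≤ 2 ^ d) :
    Real.sqrt ((1 / 2) ^ d) ≤ ((2 : ℝ) ^ (-(9 / 20) : ℝ)) ^ T *
      (((n : ℝ) + 1) ^ (-(9 / 4) : ℝ) * ((2 : ℝ) ^ (-(1 / 20) : ℝ)) ^ d) := by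
  have hD : (0 : ℝ) < 2 ^ d := by positivity
  have hn : (0 : ℝ) < (n : ℝ) + 1 := by positivity
  have e1 : Real.sqrt ((1 / 2) ^ d) = ((2 : ℝ) ^ d) ^ (-(9 / 20) : ℝ) * ((2 : ℝ) ^ d) ^ (-(1 / 20) : ℝ) := by
    rw [← Real.rpow_add hD, Real.sqrt_eq_rpow, one_div, inv_pow, Real.inv_rpow hD.le,
      ← Real.rpow_neg hD.le]
    norm_num
  have e2 : ∀ (x : ℝ) (j : ℕ), ((2 : ℝ) ^ x) ^ j = ((2 : ℝ) ^ j) ^ x := by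
    intro x j
    rw [← Real.rpow_natCast, ← Real.rpow_natCast, ← Real.rpow_mul (by norm_num),
      ← Real.rpow_mul (by norm_num), mul_comm]
  have e3 : ((n : ℝ) + 1) ^ (-(9 / 4) : ℝ) = (((n : ℝ) + 1) ^ 5) ^ (-(9 / 20) : ℝ) := by
    rw [← Real.rpow_natCast, ← Real.rpow_mul hn.le]
    norm_num
  rw [e1, e2, e2, e3, ← mul_assoc, ← Real.mul_rpow (by positivity) (by positivity)]
  refine mul_le_mul_of_nonneg_right ?_ (by positivity)
  exact Real.rpow_le_rpow_of_nonpos (by positivity) h (by norm_num)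

/-- The source of the depth constant 10: 2 · (4/5)^10 < 1/4. The rate 1/4 is the square of the
radius 2^(-n_A) used for the depth error. -/
lemma two_pow_mul_four_fifths_pow_le {n t T : ℕ} (h : 10 * n + T ≤ t) :
    (2 : ℝ) ^ n * (4 / 5) ^ t ≤ (1 / 4) ^ n * (4 / 5) ^ T := by
  have h1 : (4 / 5 : ℝ) ^ t ≤ (4 / 5) ^ (10 * n + T) :=
    pow_le_pow_of_le_one (by norm_num) (by norm_num) h
  calc (2 : ℝ) ^ n * (4 / 5) ^ t ≤ 2 ^ n * (4 / 5) ^ (10 * n + T) := by gcongr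
    _ = (2 * (4 / 5) ^ 10) ^ n * (4 / 5) ^ T := by rw [pow_add, pow_mul, mul_pow]; ring
    _ ≤ (1 / 4) ^ n * (4 / 5) ^ T := by
      refine mul_le_mul_of_nonneg_right ?_ (by positivity)
      exact pow_le_pow_left₀ (by positivity) (by norm_num) n

/-! ### Random circuits -/

/-- The two errors add up to at most 2ε²η, and Markov's inequality divides by 4ε². -/
lemma brickMeasure_traceDist_gt_le_of_le {m nA nB t : ℕ} (e : Fin nA ↪ Fin (2 * m))
    {ψ : Config (2 * m) → ℂ} (hn : nA + nB = 2 * m) (hψ : ∑ x, ‖ψ x‖ ^ 2 = 1) {ε η : ℝ}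
    (hε : 0 < ε) (h1 : 2 ^ nA * (1 / 2) ^ nB ≤ ε ^ 2 * η)
    (h2 : 2 ^ nA * (4 / 5) ^ t ≤ ε ^ 2 * η) {s : Set (Fin (t + 1) → Fin m → TwoQubitGate)}
    (hs : ∀ u, traceDist (brickOutput e ψ u) (maximallyMixed nA) ≤ ε → u ∉ s) :
    brickMeasure m (t + 1) s ≤ ENNReal.ofReal η := by
  have hsub : s ⊆ {u | ε < traceDist (brickOutput e ψ u) (maximallyMixed nA)} :=
    fun u hu => not_le.mp fun h => hs u h hu
  refine (measure_mono hsub).trans ((brickMeasure_traceDist_gt_le e hn hψ hε).trans ?_)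
  refine ENNReal.ofReal_le_ofReal ?_
  have hε2 : 0 < ε ^ 2 := by positivity
  have h3 : 0 ≤ ε ^ 2 * η := le_trans (by positivity) h1
  rw [div_le_iff₀ (by positivity)]
  linarith

lemma exists_pow_le {κ x : ℝ} (h0 : 0 < κ) (h1 : κ < 1) (hx : 0 < x) :
    ∃ T₀ : ℕ, ∀ T, T₀ ≤ T → κ ^ T ≤ x := by
  obtain ⟨T₀, hT₀⟩ := exists_pow_lt_of_lt_one hx h1
  exact ⟨T₀, fun T hT => (pow_le_pow_of_le_one h0.le h1.le hT).trans hT₀.le⟩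

theorem mixedComplexity_brickOutput_sandwich {ε η : ℝ} (hε : 0 < ε) (hη : 0 < η) :
    ∃ T : ℕ, ∀ (G : Set TwoQubitGate) (N m nA nB t : ℕ) (e : Fin nA ↪ Fin (2 * m))
      (ψ : Config (2 * m) → ℂ), nA + nB = 2 * m → ∑ x, ‖ψ x‖ ^ 2 = 1 →
      2 ^ T * 2 ^ nA ≤ 2 ^ nB → 10 * nA + T ≤ t →
      brickMeasure m t {u | ¬ ∀ δ : ℝ, ε ≤ δ →
        mixedComplexity G N (δ + ε) (maximallyMixed nA)
            ≤ mixedComplexity G N δ (brickOutput e ψ u) ∧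
          mixedComplexity G N δ (brickOutput e ψ u)
            ≤ mixedComplexity G N (δ - ε) (maximallyMixed nA)} ≤ ENNReal.ofReal η := by
  obtain ⟨T, hT⟩ := exists_pow_le (κ := 4 / 5) (by norm_num) (by norm_num)
    (by positivity : 0 < ε ^ 2 * η)
  -- The extra layer accounts for the exponent t in the bound at depth t + 1.
  refine ⟨T + 1, fun G N m nA nB t e ψ hn hψ hD ht => ?_⟩
  obtain ⟨t, rfl⟩ : ∃ t', t = t' + 1 := ⟨t - 1, by omega⟩
  refine brickMeasure_traceDist_gt_le_of_le e hn hψ hε ?_ ?_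
    (fun u hu h => h fun δ _ => mixedComplexity_sandwich G N hu)
  · have hD' : (2 : ℝ) ^ (T + 1) * 2 ^ nA ≤ 2 ^ nB := by exact_mod_cast hD
    have h1 : (2 : ℝ) ^ nA * (1 / 2) ^ nB ≤ (1 / 2) ^ (T + 1) := by
      rw [one_div, inv_pow, inv_pow, ← div_eq_mul_inv, div_le_iff₀ (by positivity),
        inv_mul_eq_div, le_div_iff₀ (by positivity), mul_comm]
      exact hD'
    refine h1.trans (le_trans ?_ (hT (T + 1) (by omega)))
    exact pow_le_pow_left₀ (by norm_num) (by norm_num) _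
  · refine (two_pow_mul_four_fifths_pow_le (T := T) (by omega)).trans ?_
    refine le_trans (mul_le_of_le_one_left (by positivity) ?_) (hT T le_rfl)
    exact pow_le_one₀ (by norm_num) (by norm_num)

theorem ae_mixedComplexity_brickOutput_eq {G : Set TwoQubitGate} {K : ℕ}
    (hK : ∀ (nA N : ℕ) (δ : ℝ), 2 * nA ≤ N → 0 ≤ δ →
      mixedComplexity G N δ (maximallyMixed nA) ≤ ((K * nA : ℕ) : ℕ∞)) (anc : ℕ → ℕ) :
    ∀ᵐ δ : ℝ, 0 < δ → ∀ η : ℝ, 0 < η → ∃ T : ℕ,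
      ∀ (m nA nB t : ℕ) (e : Fin nA ↪ Fin (2 * m)) (ψ : Config (2 * m) → ℂ),
        nA + nB = 2 * m → nA < nB → ∑ x, ‖ψ x‖ ^ 2 = 1 →
        2 ^ T * (nA + 1) ^ 5 * 2 ^ nA ≤ 2 ^ nB → 10 * nA + T ≤ t →
        brickMeasure m t {u | ¬
          (mixedComplexity G (2 * m + anc (2 * m)) δ (brickOutput e ψ u)
              = mixedComplexity G (2 * m + anc (2 * m)) δ (maximallyMixed nA) ∧
            mixedComplexity G (2 * m + anc (2 * m)) δ (maximallyMixed nA)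
              ≤ ((K * nA : ℕ) : ℕ∞))} ≤ ENNReal.ofReal η := by
  -- The exceptional set of δ is fixed before η and all sizes; the constants a and b, and through
  -- them T, depend on δ.
  filter_upwards [ae_exists_forall_mul_lt_dist
      (fun i : Σ p : ℕ × ℕ, Fin (K * p.1 + 1) =>
        threshold G (2 * i.1.1 + i.1.2 + anc (2 * i.1.1 + i.1.2)) i.1.1 i.2)
      _ (summable_register_radii K) (fun i => by positivity),
    ae_exists_forall_mul_lt_dist
      (fun i : Σ n : ℕ, Fin (K * n + 1) × Fin ((2 * K + 1) * n + 1) =>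
        threshold G i.2.2 i.1 i.2.1)
      _ (summable_depth_radii K) (fun i => by positivity)] with δ h₁ h₂ hδ η hη
  obtain ⟨a, ha, h₁⟩ := h₁
  obtain ⟨b, hb, h₂⟩ := h₂
  have hsη : 0 < Real.sqrt η := Real.sqrt_pos.mpr hη
  obtain ⟨T₁, hT₁⟩ := exists_pow_le (κ := (2 : ℝ) ^ (-(9 / 20) : ℝ)) (by positivity)
    (Real.rpow_lt_one_of_one_lt_of_neg (by norm_num) (by norm_num))
    (by positivity : 0 < a * Real.sqrt η)
  obtain ⟨T₂, hT₂⟩ := exists_pow_le (κ := 4 / 5) (by norm_num) (by norm_num)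
    (by positivity : 0 < b ^ 2 * η)
  set T := max T₁ T₂ with hT
  refine ⟨T + 1, fun m nA nB t e ψ hn hlt hψ hD ht => ?_⟩
  obtain ⟨t, rfl⟩ : ∃ t', t = t' + 1 := ⟨t - 1, by omega⟩
  obtain ⟨d, rfl⟩ : ∃ d, nB = nA + d := ⟨nB - nA, by omega⟩
  have hm : 2 * m = 2 * nA + d := by omega
  set N := 2 * m + anc (2 * m) with hN
  have hN2 : 2 * nA ≤ N := by omega
  have hB : ∀ x : ℝ, 0 ≤ x → mixedComplexity G N x (maximallyMixed nA) ≤ ((K * nA : ℕ) : ℕ∞) :=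
    fun x hx => hK nA N x hN2 hx
  -- Chosen so that r₁² η equals D_A/D_B exactly; r₂² η will absorb the depth error. The larger
  -- radius serves as the trace distance tolerance.
  set r₁ := Real.sqrt ((1 / 2) ^ d) / Real.sqrt η with hr₁
  set r₂ := b * (1 / 2) ^ nA with hr₂
  have hr₁0 : 0 < r₁ := by positivity
  have hD' : (2 : ℝ) ^ (T + 1) * ((nA : ℝ) + 1) ^ 5 ≤ 2 ^ d := by
    have h : (2 : ℝ) ^ (T + 1) * ((nA : ℝ) + 1) ^ 5 * 2 ^ nA ≤ 2 ^ d * 2 ^ nA := by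
      rw [← pow_add, add_comm d nA]
      exact_mod_cast hD
    exact le_of_mul_le_mul_right h (by positivity)
  have hdist : ∀ s ≤ K * nA, max r₁ r₂ < |δ - threshold G N nA s| := by
    intro s hs
    refine max_lt ?_ ?_
    · have h := h₁ ⟨(nA, d), ⟨s, Nat.lt_succ_of_le hs⟩⟩
      simp only [← hm, ← hN] at h
      refine lt_of_le_of_lt ?_ h
      rw [hr₁, div_le_iff₀ hsη]
      refine (sqrt_inv_two_pow_le hD').trans ?_
      calc _ ≤ a * Real.sqrt η * (((nA : ℝ) + 1) ^ (-(9 / 4) : ℝ) *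
            ((2 : ℝ) ^ (-(1 / 20) : ℝ)) ^ d) :=
          mul_le_mul_of_nonneg_right (hT₁ _ (by omega)) (by positivity)
        _ = _ := by ring
    · have h := h₂ ⟨nA, ⟨s, Nat.lt_succ_of_le hs⟩,
        ⟨min N ((2 * K + 1) * nA), Nat.lt_succ_of_le (min_le_right _ _)⟩⟩
      -- Levels s ≤ K n_A need at most n_A + 2s ≤ (2K + 1) n_A qubits, so larger registers have the
      -- same threshold.
      have heq : threshold G (min N ((2 * K + 1) * nA)) nA s = threshold G N nA s := by
        rcases le_total N ((2 * K + 1) * nA) with hle | hle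
        · rw [min_eq_left hle]
        · rw [min_eq_right hle]
          have : nA + 2 * s ≤ (2 * K + 1) * nA := by nlinarith
          exact threshold_eq_of_card_le this (this.trans hle)
      simp only [heq] at h
      exact h
  refine brickMeasure_traceDist_gt_le_of_le e hn hψ (lt_max_of_lt_left hr₁0 : 0 < max r₁ r₂) ?_ ?_
    (fun u hu h => h ⟨mixedComplexity_eq_of_threshold hB hδ (hr₁0.le.trans (le_max_left _ _))
      hdist hu, hB δ hδ.le⟩)
  · calc (2 : ℝ) ^ nA * (1 / 2) ^ (nA + d) = (1 / 2) ^ d := by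
          rw [pow_add, ← mul_assoc, ← mul_pow]; norm_num
      _ = r₁ ^ 2 * η := by
          rw [hr₁, div_pow (Real.sqrt _), Real.sq_sqrt (by positivity), Real.sq_sqrt hη.le,
            div_mul_cancel₀ _ hη.ne']
      _ ≤ max r₁ r₂ ^ 2 * η := by gcongr; exact le_max_left _ _
  · calc (2 : ℝ) ^ nA * (4 / 5) ^ t ≤ (1 / 4) ^ nA * (4 / 5) ^ T :=
          two_pow_mul_four_fifths_pow_le (by omega)
      _ ≤ (1 / 4) ^ nA * (b ^ 2 * η) := by
          gcongr; exact hT₂ T (le_max_right _ _)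
      _ = r₂ ^ 2 * η := by
          rw [hr₂, mul_pow, ← pow_mul, mul_comm nA 2, pow_mul]; norm_num; ring
      _ ≤ max r₁ r₂ ^ 2 * η := by gcongr; exact le_max_right _ _

end
theorem mainTheorem5 :
    ∃ c : ℕ,
      -- every gate set, every register, all tolerances `δ ≥ ε` at once
      (∀ ε : ℝ, 0 < ε → ∀ η : ℝ, 0 < η → ∃ T : ℕ,
        ∀ (G : Set TwoQubitGate) (N m nA nB t : ℕ) (e : Fin nA ↪ Fin (2 * m))
          (ψ : Config (2 * m) → ℂ),
          nA + nB = 2 * m → nA < nB → IsContiguous e → ∑ x, ‖ψ x‖ ^ 2 = 1 →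
          2 ^ T * 2 ^ nA ≤ 2 ^ nB → c * nA + T ≤ t →
          brickMeasure m t {u | ¬ ∀ δ : ℝ, ε ≤ δ →
            mixedComplexity G N (δ + ε) (maximallyMixed nA)
                ≤ mixedComplexity G N δ (brickOutput e ψ u) ∧
              mixedComplexity G N δ (brickOutput e ψ u)
                ≤ mixedComplexity G N (δ - ε) (maximallyMixed nA)}
            ≤ ENNReal.ofReal η) ∧
      (∀ G : Set TwoQubitGate, PreparesEPR G → ∃ K : ℕ,
        -- the complexity of the maximally mixed state
        (∀ (nA N : ℕ) (δ : ℝ), 2 * nA ≤ N → 0 ≤ δ →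
          mixedComplexity G N δ (maximallyMixed nA) ≤ ((K * nA : ℕ) : ℕ∞)) ∧
        -- exact equality, with `anc n` ancillas next to the `n` qubits of the system
        (∀ anc : ℕ → ℕ, ∀ᵐ δ : ℝ, 0 < δ → ∀ η : ℝ, 0 < η → ∃ T : ℕ,
          ∀ (m nA nB t : ℕ) (e : Fin nA ↪ Fin (2 * m)) (ψ : Config (2 * m) → ℂ),
            nA + nB = 2 * m → nA < nB → IsContiguous e → ∑ x, ‖ψ x‖ ^ 2 = 1 →
            2 ^ T * (nA + 1) ^ 5 * 2 ^ nA ≤ 2 ^ nB → c * nA + T ≤ t →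
            brickMeasure m t {u | ¬
              (mixedComplexity G (2 * m + anc (2 * m)) δ (brickOutput e ψ u)
                  = mixedComplexity G (2 * m + anc (2 * m)) δ (maximallyMixed nA) ∧
                mixedComplexity G (2 * m + anc (2 * m)) δ (maximallyMixed nA)
                  ≤ ((K * nA : ℕ) : ℕ∞))}
              ≤ ENNReal.ofReal η)) := by
  refine ⟨10, fun ε hε η hη => ?_, fun G hG => ?_⟩
  · obtain ⟨T, hT⟩ := mixedComplexity_brickOutput_sandwich hε hη
    exact ⟨T, fun G N m nA nB t e ψ hn _ _ hψ hD ht => hT G N m nA nB t e ψ hn hψ hD ht⟩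
  · obtain ⟨K, hK⟩ := hG.exists_mixedComplexity_le
    refine ⟨K, hK, fun anc => ?_⟩
    filter_upwards [ae_mixedComplexity_brickOutput_eq hK anc] with δ h hδ η hη
    obtain ⟨T, hT⟩ := h hδ η hη
    exact ⟨T, fun m nA nB t e ψ hn hlt _ hψ hD ht => hT m nA nB t e ψ hn hlt hψ hD ht⟩
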